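/- **Theorem 3.4.** *Conventions.* A 2-complex is a graph (loops and multiple edges allowed, not necessarily finite) together with 2-cells attached along closed edge paths of positive length, reduced or not. A combinatorial map sends open cells homeomorphically to open cells; it is an immersion if it is locally injective. An edge is *free* if it is used exactly once in the attaching path of exactly one 2-cell. A vertex is *free* if exactly one edge contains it, this edge meets it only once, and this edge is not in the boundary of any 2-cell (so that the edge can be collapsed from that vertex). A 2-complex $K$ has *collapsing non-positive immersion* if for every combinatorial immersion $X\to K$, where $X$ is finite, connected, and without free vertices or edges, either $\chi(X)\le 0$ or $X$ is a point. The link $lk(v,L)$ of a vertex $v$ is the graph whose vertices are the ends of edges at $v$ and whose edges are the corners of 2-cells at $v$. A *zero/one-angle structure* on $L$ assigns an angle $\omega(c)\in\{0,1\}$ to every corner $c$ of a 2-cell of $L$, and $lk_0(v,L)$ is the subgraph of $lk(v,L)$ consisting of all its vertices and the corners of angle $0$; for a subcomplex $K$ of $L$ the graph $lk_0(v,K)\subseteq lk_0(v,L)$ is defined in the same way (it is empty if $v\notin K$). The curvature of a 2-cell $d$ is $\kappa(d,L)=\sum\omega(c_j)-(|\partial d|-2)$, the sum being over the corners of $d$,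 where $|\partial d|$ is the length of its attaching path. A cycle in a graph is *reduced* if no edge in it is followed cyclically by its inverse. For a subgraph $\Lambda'$ of a graph $\Lambda$, $\Lambda$ is a *strong forest relative to $\Lambda'$* if every reduced cycle in $\Lambda$ is contained in $\Lambda'$ and for every connected component $C$ of $\Lambda$ the intersection $C\cap\Lambda'$ is empty or connected. The pair $(L,K)$ with a zero/one-angle structure satisfies the *strong relative coloring test* if 1. $\kappa(d,L)\le 0$ for every 2-cell $d$ of $L$; 2. $lk_0(v,L)$ is a strong forest relative to $lk_0(v,K)$ for every vertex $v$ of $L$; 3. if a corner of angle $1$ of a 2-cell $d$ of $L$ has its vertices in a single connected component of $lk_0(v,L)$, then $d\in K$. Suppose the edges of $L$ are directed. The zero/one-angle structure is *standard* on a subcomplex $K$ if a corner of a 2-cell of $K$ has angle $0$ when both its ends are starts of edges or both are ends of edges, and angle $1$ otherwise. If all 2-cells of $K$ are attached along closed paths of exponent sum zero (with respect to the directions), the *maximal expansion* $(\hat L,\hat K)$ of $(L,K)$ is obtained by attaching to both $K$ and $L$ a 2-cell along every closed path of positive length and exponent sum zero in $K$, reduced or not. *Statement.* Let $L$ be a 2-complex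 with directed edges and $K$ a subcomplex all of whose 2-cells are attached along closed paths of exponent sum zero. Assume that 1. $(\hat L,\hat K)$ carries a zero/one-angle structure which satisfies the strong relative coloring test; 2. this angle structure is standard on $\hat K$; 3. $K$ has collapsing non-positive immersion. Then $L$ has collapsing non-positive immersion. -/

import Mathlib

universe u

/-! ### Graphs

Graphs may have loops and multiple edges. Every (unoriented) edge is given by its two
orientations, which are called darts and are exchanged by `inv`. -/

structure SerreGraph : Type (u + 1) where
  Vert : Type u
  Dart : Type u
  src : Dart → Vert
  inv : Dart → Dart
  inv_inv : ∀ d, inv (inv d) = d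
  inv_ne : ∀ d, inv d ≠ d

namespace SerreGraph

def tgt (Γ : SerreGraph.{u}) (d : Γ.Dart) : Γ.Vert := Γ.src (Γ.inv d)

/-- The edges: the unordered pairs consisting of a dart and its inverse. -/
def Edge (Γ : SerreGraph.{u}) : Type u := {s : Sym2 Γ.Dart // ∃ d, s = s(d, Γ.inv d)}

/-- A cyclic sequence of `n` darts (`n` positive) is a closed path when each dart ends where the
next one starts. -/
def IsClosedPath (Γ : SerreGraph.{u}) {n : ℕ} (p : ZMod n → Γ.Dart) : Prop :=
  ∀ i, Γ.tgt (p i) = Γ.src (p (i + 1))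

/-- No dart is (cyclically) followed by its inverse. -/
def IsReduced (Γ : SerreGraph.{u}) {n : ℕ} (p : ZMod n → Γ.Dart) : Prop :=
  ∀ i, p (i + 1) ≠ Γ.inv (p i)

/-- Nonempty, and any two vertices are joined by an edge path. -/
def IsConnected (Γ : SerreGraph.{u}) : Prop :=
  Nonempty Γ.Vert ∧
    ∀ a b : Γ.Vert, Relation.ReflTransGen (fun x y => ∃ d, Γ.src d = x ∧ Γ.tgt d = y) a b

/-- A direction for every edge: exactly one of its two darts is positive. -/
structure Orientation (Γ : SerreGraph.{u}) : Type u where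
  pos : Γ.Dart → Prop
  pos_inv : ∀ d, pos (Γ.inv d) ↔ ¬ pos d

open Classical in
/-- The exponent sum of a closed path in a directed graph. -/
noncomputable def Orientation.expSum {Γ : SerreGraph.{u}} (o : Γ.Orientation) {n : ℕ} [NeZero n]
    (p : ZMod n → Γ.Dart) : ℤ :=
  ∑ i, if o.pos (p i) then 1 else -1

structure Subgraph (Γ : SerreGraph.{u}) : Type u where
  verts : Set Γ.Vert
  darts : Set Γ.Dart
  src_mem : ∀ d ∈ darts, Γ.src d ∈ verts
  inv_mem : ∀ d ∈ darts, Γ.inv d ∈ darts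

/-- There is an edge path in the subgraph `Λ` from `a` to `b`; for vertices of `Λ` this means that
they lie in the same connected component of `Λ`. -/
def Subgraph.Joined {Γ : SerreGraph.{u}} (Λ : Γ.Subgraph) (a b : Γ.Vert) : Prop :=
  Relation.ReflTransGen (fun x y => ∃ d ∈ Λ.darts, Γ.src d = x ∧ Γ.tgt d = y) a b

/-- `Λ` is a forest relative to its subgraph `Λ'`: every reduced cycle in `Λ` is contained
in `Λ'`. -/
def Subgraph.IsForestRel {Γ : SerreGraph.{u}} (Λ Λ' : Γ.Subgraph) : Prop :=
  ∀ (n : ℕ) [NeZero n] (p : ZMod n → Γ.Dart), (∀ i, p i ∈ Λ.darts) → Γ.IsClosedPath p →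
    Γ.IsReduced p → ∀ i, p i ∈ Λ'.darts

/-- `Λ` is a strong forest relative to its subgraph `Λ'`: in addition, for every connected
component `C` of `Λ`, the intersection of `C` and `Λ'` is empty or connected; that is, any two
vertices of `Λ'` in one component of `Λ` are joined in `Λ'`. -/
def Subgraph.IsStrongForestRel {Γ : SerreGraph.{u}} (Λ Λ' : Γ.Subgraph) : Prop :=
  Λ.IsForestRel Λ' ∧
    ∀ a ∈ Λ'.verts, ∀ b ∈ Λ'.verts, Λ.Joined a b → Λ'.Joined a b

end SerreGraph

/-! ### 2-complexes -/

/-- A 2-complex: a graph together with 2-cells attached along closed edge paths of positive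
length. The boundary of the 2-cell `f` is the closed path of its sides
`bd f i`, `i : ZMod (len f)`. -/
structure TwoComplex : Type (u + 1) extends SerreGraph.{u} where
  Face : Type u
  len : Face → ℕ
  len_ne : ∀ f, NeZero (len f)
  bd : ∀ f, ZMod (len f) → Dart
  bd_closed : ∀ f, toSerreGraph.IsClosedPath (bd f)

namespace TwoComplex

instance instNeZeroLen (L : TwoComplex.{u}) (f : L.Face) : NeZero (L.len f) := L.len_ne f

/-- The corners of 2-cells: the corner `⟨f, i⟩` lies between the sides `i` and `i + 1` of `f`. -/
abbrev Corner (L : TwoComplex.{u}) : Type u := Σ f : L.Face, ZMod (L.len f)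

/-- The vertex at which a corner sits. -/
def cornerVert (L : TwoComplex.{u}) (c : L.Corner) : L.Vert := L.tgt (L.bd c.1 c.2)

/-- The first end of a corner, as a dart leaving the vertex of the corner. -/
def cornerFst (L : TwoComplex.{u}) (c : L.Corner) : L.Dart := L.inv (L.bd c.1 c.2)

/-- The second end of a corner, as a dart leaving the vertex of the corner. -/
def cornerSnd (L : TwoComplex.{u}) (c : L.Corner) : L.Dart := L.bd c.1 (c.2 + 1)

theorem src_cornerFst (L : TwoComplex.{u}) (c : L.Corner) :
    L.src (L.cornerFst c) = L.cornerVert c := rfl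

theorem src_cornerSnd (L : TwoComplex.{u}) (c : L.Corner) :
    L.src (L.cornerSnd c) = L.cornerVert c := (L.bd_closed c.1 c.2).symm

/-- The link of a vertex `v`. Its vertices are the darts leaving `v` (the ends of edges at `v`) and
its edges are the corners at `v`. A dart of the link is a corner with one of its two orientations:
`(c, false)` runs from `cornerFst c` to `cornerSnd c`, and `(c, true)` runs backwards. -/
def link (L : TwoComplex.{u}) (v : L.Vert) : SerreGraph.{u} where
  Vert := {d : L.Dart // L.src d = v}
  Dart := {c : L.Corner // L.cornerVert c = v} × Bool
  src x :=
    match x with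
    | (c, false) => ⟨L.cornerFst c.1, (L.src_cornerFst c.1).trans c.2⟩
    | (c, true) => ⟨L.cornerSnd c.1, (L.src_cornerSnd c.1).trans c.2⟩
  inv x := (x.1, !x.2)
  inv_inv x := by simp
  inv_ne x h := by simpa using congrArg Prod.snd h

/-- Finitely many cells. -/
def IsFinite (X : TwoComplex.{u}) : Prop := Finite X.Vert ∧ Finite X.Dart ∧ Finite X.Face

/-- The Euler characteristic (of a finite 2-complex). -/
noncomputable def euler (X : TwoComplex.{u}) : ℤ :=
  (Nat.card X.Vert : ℤ) - Nat.card X.Edge + Nat.card X.Face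

def IsPoint (X : TwoComplex.{u}) : Prop :=
  Nat.card X.Vert = 1 ∧ IsEmpty X.Dart ∧ IsEmpty X.Face

/-- The edge with the orientations `d`, `inv d` is free: it is used exactly once in the attaching
path of exactly one 2-cell. -/
def IsFreeEdge (X : TwoComplex.{u}) (d : X.Dart) : Prop :=
  ∃! s : Σ f : X.Face, ZMod (X.len f), X.bd s.1 s.2 = d ∨ X.bd s.1 s.2 = X.inv d

/-- The vertex `v` is free: it is an endpoint, once, of exactly one edge, and (so that this edge can
be collapsed from `v`) that edge is not in the boundary of a 2-cell. -/
def IsFreeVert (X : TwoComplex.{u}) (v : X.Vert) : Prop :=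
  ∃ d, X.src d = v ∧ (∀ d', X.src d' = v → d' = d) ∧
    ∀ f i, X.bd f i ≠ d ∧ X.bd f i ≠ X.inv d

/-! ### Combinatorial maps and immersions -/

/-- A combinatorial map. Edges are mapped to edges (either way round), 2-cells to 2-cells. The
sides of `f` are mapped bijectively onto the sides of its image, in the same cyclic order if
`flip f = false` and in the opposite cyclic order if `flip f = true`. -/
structure Hom (X L : TwoComplex.{u}) : Type u where
  onVert : X.Vert → L.Vert
  onDart : X.Dart → L.Dart
  onFace : X.Face → L.Face
  flip : X.Face → Bool
  onSide : ∀ f, ZMod (X.len f) ≃ ZMod (L.len (onFace f))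
  src_onDart : ∀ d, L.src (onDart d) = onVert (X.src d)
  inv_onDart : ∀ d, L.inv (onDart d) = onDart (X.inv d)
  onSide_of_not_flip : ∀ f, flip f = false → ∀ i,
    onSide f (i + 1) = onSide f i + 1 ∧ L.bd (onFace f) (onSide f i) = onDart (X.bd f i)
  onSide_of_flip : ∀ f, flip f = true → ∀ i,
    onSide f (i + 1) = onSide f i - 1 ∧ L.bd (onFace f) (onSide f i) = L.inv (onDart (X.bd f i))

/-- The induced map on corners: the corner between the sides `i` and `i + 1` goes to the corner
between the images of these sides. -/
def Hom.onCorner {X L : TwoComplex.{u}} (φ : X.Hom L) (c : X.Corner) : L.Corner :=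
  ⟨φ.onFace c.1, if φ.flip c.1 then φ.onSide c.1 (c.2 + 1) else φ.onSide c.1 c.2⟩

/-- A combinatorial map is an immersion if it is locally injective. As a neighbourhood of a vertex
is a cone on its link, this says that the induced maps of links are injective, on the vertices and
on the edges of the links; local injectivity at the points of open edges then follows. -/
def Hom.IsImmersion {X L : TwoComplex.{u}} (φ : X.Hom L) : Prop :=
  (∀ d d', X.src d = X.src d' → φ.onDart d = φ.onDart d' → d = d') ∧
  (∀ c c', X.cornerVert c = X.cornerVert c' → φ.onCorner c = φ.onCorner c' → c = c')

/-- Collapsing non-positive immersion. -/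
def CollapsingNPI (K : TwoComplex.{u}) : Prop :=
  ∀ (X : TwoComplex.{u}) (φ : X.Hom K), φ.IsImmersion → X.IsFinite → X.IsConnected →
    (∀ v, ¬ X.IsFreeVert v) → (∀ d, ¬ X.IsFreeEdge d) → X.euler ≤ 0 ∨ X.IsPoint

/-! ### Subcomplexes -/

structure Subcomplex (L : TwoComplex.{u}) : Type u where
  verts : Set L.Vert
  darts : Set L.Dart
  faces : Set L.Face
  src_mem : ∀ d ∈ darts, L.src d ∈ verts
  inv_mem : ∀ d ∈ darts, L.inv d ∈ darts
  bd_mem : ∀ f ∈ faces, ∀ i, L.bd f i ∈ darts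

/-- All of `L`. -/
def Subcomplex.full (L : TwoComplex.{u}) : L.Subcomplex where
  verts := Set.univ
  darts := Set.univ
  faces := Set.univ
  src_mem _ _ := trivial
  inv_mem _ _ := trivial
  bd_mem _ _ _ := trivial

/-- A subcomplex as a 2-complex of its own. -/
def Subcomplex.toComplex {L : TwoComplex.{u}} (K : L.Subcomplex) : TwoComplex.{u} where
  Vert := K.verts
  Dart := K.darts
  src d := ⟨L.src d.1, K.src_mem d.1 d.2⟩
  inv d := ⟨L.inv d.1, K.inv_mem d.1 d.2⟩
  inv_inv d := Subtype.ext (L.inv_inv d.1)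
  inv_ne d h := L.inv_ne d.1 (congrArg Subtype.val h)
  Face := K.faces
  len f := L.len f.1
  len_ne f := L.len_ne f.1
  bd f i := ⟨L.bd f.1 i, K.bd_mem f.1 f.2 i⟩
  bd_closed f i := Subtype.ext (L.bd_closed f.1 i)

/-! ### Angle structures -/

/-- All angles are 0 or 1. -/
def IsZeroOne (L : TwoComplex.{u}) (ω : L.Corner → ℤ) : Prop := ∀ c, ω c = 0 ∨ ω c = 1

/-- The curvature of a 2-cell: the sum of its angles minus (the length of its boundary minus 2). -/
def faceCurvature (L : TwoComplex.{u}) (ω : L.Corner → ℤ) (f : L.Face) : ℤ :=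
  ∑ i : ZMod (L.len f), ω ⟨f, i⟩ - ((L.len f : ℤ) - 2)

/-- For a subcomplex `K` of `L`, the graph `lk₀(v, K)` as a subgraph of the link of `v` in `L`: all
vertices of the link of `v` in `K`, and the corners of 2-cells of `K` at `v` with angle 0.
It is empty if `v` is not in `K`. -/
def Subcomplex.lk0 {L : TwoComplex.{u}} (K : L.Subcomplex) (ω : L.Corner → ℤ) (v : L.Vert) :
    (L.link v).Subgraph where
  verts := {d : {d : L.Dart // L.src d = v} | d.1 ∈ K.darts}
  darts := {x : {c : L.Corner // L.cornerVert c = v} × Bool |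
    x.1.1.1 ∈ K.faces ∧ ω x.1.1 = 0}
  src_mem := by
    rintro ⟨c, b⟩ ⟨hc, -⟩
    cases b
    · exact K.inv_mem _ (K.bd_mem _ hc _)
    · exact K.bd_mem _ hc _
  inv_mem _ h := h

/-- The strong relative coloring test for the pair `(L, K)` with zero/one-angles `ω`. -/
def StrongRelColoringTest (L : TwoComplex.{u}) (K : L.Subcomplex) (ω : L.Corner → ℤ) : Prop :=
  (∀ f, L.faceCurvature ω f ≤ 0) ∧
  (∀ v, ((Subcomplex.full L).lk0 ω v).IsStrongForestRel (K.lk0 ω v)) ∧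
  (∀ (v : L.Vert) (c : {c : L.Corner // L.cornerVert c = v}), ω c.1 = 1 →
    ((Subcomplex.full L).lk0 ω v).Joined ((L.link v).src (c, false)) ((L.link v).tgt (c, false)) →
    c.1.1 ∈ K.faces)

/-- The angles of the 2-cells of `K` are the standard ones: a corner has angle 0 if both of its ends
are starts of edges or both are ends of edges (in the chosen directions of the edges), and angle 1
if it is mixed. -/
def Subcomplex.IsStandardOn {L : TwoComplex.{u}} (K : L.Subcomplex) (o : L.Orientation)
    (ω : L.Corner → ℤ) : Prop :=
  ∀ c : L.Corner, c.1 ∈ K.faces →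
    ((o.pos (L.cornerFst c) ↔ o.pos (L.cornerSnd c)) → ω c = 0) ∧
    (¬ (o.pos (L.cornerFst c) ↔ o.pos (L.cornerSnd c)) → ω c = 1)

/-- All 2-cells of `K` are attached along closed paths of exponent sum zero. -/
def Subcomplex.ExpSumZero {L : TwoComplex.{u}} (K : L.Subcomplex) (o : L.Orientation) : Prop :=
  ∀ f ∈ K.faces, o.expSum (L.bd f) = 0

/-! ### The maximal expansion -/

/-- The closed paths (of positive length, reduced or not) of exponent sum zero in `K`. -/
structure Subcomplex.ZeroLoop {L : TwoComplex.{u}} (K : L.Subcomplex) (o : L.Orientation) :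
    Type u where
  len : ℕ
  [len_ne : NeZero len]
  path : ZMod len → L.Dart
  path_mem : ∀ i, path i ∈ K.darts
  closed : L.IsClosedPath path
  expSum_eq : o.expSum path = 0

/-- `L̂`: the 2-complex `L` together with one new 2-cell for every closed path of exponent sum
zero in `K`, attached along that path. -/
def maxExpansion (L : TwoComplex.{u}) (K : L.Subcomplex) (o : L.Orientation) :
    TwoComplex.{u} where
  toSerreGraph := L.toSerreGraph
  Face := L.Face ⊕ K.ZeroLoop o
  len := Sum.elim L.len (fun l => l.len)
  len_ne
    | Sum.inl f => L.len_ne f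
    | Sum.inr l => l.len_ne
  bd
    | Sum.inl f => L.bd f
    | Sum.inr l => l.path
  bd_closed
    | Sum.inl f => L.bd_closed f
    | Sum.inr l => l.closed

/-- `K̂`: the subcomplex of `L̂` that consists of `K` and all the new 2-cells. -/
def Subcomplex.maxExpansion {L : TwoComplex.{u}} (K : L.Subcomplex) (o : L.Orientation) :
    (L.maxExpansion K o).Subcomplex where
  verts := K.verts
  darts := K.darts
  faces := {f : L.Face ⊕ K.ZeroLoop o | ∀ f₀, f = Sum.inl f₀ → f₀ ∈ K.faces}
  src_mem := K.src_mem
  inv_mem := K.inv_mem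
  bd_mem
    | Sum.inl f, hf, i => K.bd_mem f (hf f rfl) i
    | Sum.inr l, _, i => l.path_mem i

end TwoComplex

/-! Let X → L be an immersion as in `CollapsingNPI`, and let Y be the preimage of K together with
all vertices of X (`Hom.preimage`). Counting darts instead of edges, 2χ(X) is the sum of 2χ(C) over
the components C of Y, minus the number of darts outside Y, plus twice the number of faces outside
Y. Nonpositive curvature gives each outside face at least two corners of angle 0. So it is enough
that 2χ(C) is at most the sum over the vertices of C of the `excess`, the number of outside darts
minus the number of outside corners of angle 0 (`euler_nonpos_of_components`).

Local part. In L̂ any two darts of K with the same initial vertex span a corner of K̂, which has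
angle 0 if their signs agree. Hence the darts of Y at a vertex may be collapsed to two points + and
-, and the outside corners of angle 0 still form a forest on these points and the outside darts. The
points + and - lie in different components of it: the forest is strong, and signs are constant along
`lk0` of K̂. So the excess is nonnegative (`IsSeparated.card_outZeros_le`). At a vertex that meets
the outside, if the outside corners involve darts of Y of at most one sign, or of none, the absence
of free edges raises the bound to 1, or to 2 with one degenerate exception
(`IsSeparated.card_outZeros_lt`).

Global part. If χ(C) > 0, the hypothesis on K makes C collapsible (`Subcomplex.collapsible`), so
χ(C) = 1 and C carries a height function that follows the directions. Among the vertices of C that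
meet the outside, a highest and a lowest one see only one sign, so two different vertices contribute
at least 2 (`IsSeparated.chi2_component_le`). A unique such vertex sees no sign and contributes 2
alone; in the degenerate case C could be collapsed towards it, and X would have free cells. If C
does not meet the outside, Y is all of X, and the hypothesis on K applies to X itself. -/

/-! ### Counting edges -/

open Classical in
/-- Suppose that every edge `e` of a finite graph with vertex set `V` separates its two endpoints,
as witnessed by the set `g e`. Then the number of edges plus the number of linearly independent
locally constant functions is at most the number of vertices. -/
theorem card_add_card_le_of_separating {A B ι : Type*} [Fintype ι] (V : Finset A) (E : Finset B)
    (s t : B → A) (hs : ∀ e ∈ E, s e ∈ V) (ht : ∀ e ∈ E, t e ∈ V) (g : B → A → Prop)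
    (hg : ∀ e ∈ E, g e (s e) ∧ ¬ g e (t e))
    (hg' : ∀ e ∈ E, ∀ e' ∈ E, e' ≠ e → (g e (s e') ↔ g e (t e')))
    (h : ι → A → ℚ) (hh : ∀ i, ∀ e ∈ E, h i (s e) = h i (t e))
    (hi : ∀ b : ι → ℚ, (∀ a ∈ V, ∑ i, b i * h i a = 0) → ∀ i, b i = 0) :
    E.card + Fintype.card ι ≤ V.card := by
  let w : E ⊕ ι → (V → ℚ) :=
    Sum.elim (fun e a => if g e a then 1 else 0) (fun i a => h i a)
  have hw : LinearIndependent ℚ w := by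
    rw [Fintype.linearIndependent_iff]
    intro b hb
    have hb' : ∀ a ∈ V, (∑ e : E, b (Sum.inl e) * (if g e a then (1 : ℚ) else 0)) +
        ∑ i, b (Sum.inr i) * h i a = 0 := by
      intro a ha
      have := congrFun hb ⟨a, ha⟩
      simpa [w, Fintype.sum_sum_type] using this
    have h1 : ∀ e : E, b (Sum.inl e) = 0 := by
      intro e
      have e1 := hb' _ (hs e e.2)
      have e2 := hb' _ (ht e e.2)
      have e3 : ∑ i, b (Sum.inr i) * h i (s e) = ∑ i, b (Sum.inr i) * h i (t e) :=
        Finset.sum_congr rfl fun i _ => by rw [hh i e e.2]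
      -- Between the two ends of `e` only the indicator of `g e` jumps, so subtracting the two
      -- equations isolates its coefficient.
      have e4 : (∑ e' : E, b (Sum.inl e') * (if g e' (s e) then (1 : ℚ) else 0)) -
          (∑ e' : E, b (Sum.inl e') * (if g e' (t e) then (1 : ℚ) else 0)) = b (Sum.inl e) := by
        rw [← Finset.sum_sub_distrib, Finset.sum_eq_single e]
        · simp [(hg e e.2).1, (hg e e.2).2]
        · intro e' _ hne
          have := hg' e' e'.2 e e.2 (fun hc => hne (Subtype.ext hc.symm))
          simp [this]
        · simp
      linarith
    have h2 := hi (fun i => b (Sum.inr i)) (fun a ha => by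
      have := hb' a ha
      simpa [h1] using this)
    rintro (e | i)
    · exact h1 e
    · exact h2 i
  have := hw.fintype_card_le_finrank
  simpa using this

/-- A nonempty forest has at least one component; the locally constant function is 1. -/
theorem card_add_one_le_of_separating {A B : Type*} (V : Finset A) (E : Finset B)
    (s t : B → A) (hs : ∀ e ∈ E, s e ∈ V) (ht : ∀ e ∈ E, t e ∈ V) (g : B → A → Prop)
    (hg : ∀ e ∈ E, g e (s e) ∧ ¬ g e (t e))
    (hg' : ∀ e ∈ E, ∀ e' ∈ E, e' ≠ e → (g e (s e') ↔ g e (t e')))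
    (hV : V.Nonempty) : E.card + 1 ≤ V.card := by
  obtain ⟨a, ha⟩ := hV
  refine card_add_card_le_of_separating (ι := Unit) V E s t hs ht g hg hg' (fun _ _ => 1)
    (fun _ _ _ => rfl) ?_
  intro b hb _
  simpa using hb a ha

-- The indicator of `P` is a second locally constant function, independent of 1 because `P`
-- separates `x` from `y`: the forest has at least two components.
open Classical in
theorem card_add_two_le_of_separating {A B : Type*} (V : Finset A) (E : Finset B)
    (s t : B → A) (hs : ∀ e ∈ E, s e ∈ V) (ht : ∀ e ∈ E, t e ∈ V) (g : B → A → Prop)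
    (hg : ∀ e ∈ E, g e (s e) ∧ ¬ g e (t e))
    (hg' : ∀ e ∈ E, ∀ e' ∈ E, e' ≠ e → (g e (s e') ↔ g e (t e')))
    (P : A → Prop) (hP : ∀ e ∈ E, P (s e) ↔ P (t e)) {x y : A} (hx : x ∈ V) (hy : y ∈ V)
    (hPx : P x) (hPy : ¬ P y) : E.card + 2 ≤ V.card := by
  refine card_add_card_le_of_separating (ι := Bool) V E s t hs ht g hg hg'
    (fun i a => if i then (if P a then 1 else 0) else 1) ?_ ?_
  · rintro (_ | _) e he
    · rfl
    · simp [hP e he]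
  · intro b hb
    have h1 := hb x hx
    have h2 := hb y hy
    simp [hPx, hPy] at h1 h2
    rintro (_ | _)
    · exact h2
    · linarith

/-! ### Reduced cycles -/

namespace SerreGraph

/-- `l` is a reduced edge path from `a` to `b` with darts in `S`. -/
inductive ReducedPath (Γ : SerreGraph.{u}) (S : Set Γ.Dart) (b : Γ.Vert) :
    Γ.Vert → List Γ.Dart → Prop
  | nil : ReducedPath Γ S b b []
  | cons (d : Γ.Dart) (l : List Γ.Dart) : d ∈ S → ReducedPath Γ S b (Γ.tgt d) l →
      (∀ d' ∈ l.head?, d' ≠ Γ.inv d) → ReducedPath Γ S b (Γ.src d) (d :: l)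

theorem ReducedPath.eq_of_nil {Γ : SerreGraph.{u}} {S : Set Γ.Dart} {a b : Γ.Vert}
    (h : Γ.ReducedPath S b a []) : a = b := by
  cases h with
  | nil => rfl

theorem ReducedPath.mem {Γ : SerreGraph.{u}} {S : Set Γ.Dart} {a b : Γ.Vert} {l : List Γ.Dart}
    (h : Γ.ReducedPath S b a l) : ∀ d ∈ l, d ∈ S := by
  induction h with
  | nil => simp
  | cons d l hd _ _ ih => simpa [hd] using ih

theorem ReducedPath.mono {Γ : SerreGraph.{u}} {S T : Set Γ.Dart} (hST : S ⊆ T) {a b : Γ.Vert}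
    {l : List Γ.Dart} (h : Γ.ReducedPath S b a l) : Γ.ReducedPath T b a l := by
  induction h with
  | nil => exact .nil
  | cons d l hd _ h' ih => exact .cons d l (hST hd) ih h'

theorem ReducedPath.src_head {Γ : SerreGraph.{u}} {S : Set Γ.Dart} {a b : Γ.Vert}
    {l : List Γ.Dart} (h : Γ.ReducedPath S b a l) : ∀ d ∈ l.head?, Γ.src d = a := by
  cases h with
  | nil => simp
  | cons d l hd _ _ => simp

theorem ReducedPath.tgt_last {Γ : SerreGraph.{u}} {S : Set Γ.Dart} {a b : Γ.Vert}
    {l : List Γ.Dart} (h : Γ.ReducedPath S b a l) : ∀ d ∈ l.getLast?, Γ.tgt d = b := by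
  induction h with
  | nil => simp
  | cons d l hd h1 h2 ih =>
    cases l with
    | nil => simpa using h1.eq_of_nil
    | cons d' l => simpa using ih

theorem ReducedPath.step {Γ : SerreGraph.{u}} {S : Set Γ.Dart} {a b : Γ.Vert}
    {l : List Γ.Dart} (h : Γ.ReducedPath S b a l) : ∀ i (hi : i + 1 < l.length),
    Γ.tgt l[i] = Γ.src l[i + 1] ∧ l[i + 1] ≠ Γ.inv l[i] := by
  induction h with
  | nil => simp
  | cons d l hd h1 h2 ih =>
    intro i hi
    cases i with
    | zero =>
      have hl : 0 < l.length := by simpa using hi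
      have hh : l[0] ∈ l.head? := by simp [List.head?_eq_getElem?, hl]
      exact ⟨(h1.src_head _ hh).symm, h2 _ hh⟩
    | succ i => simpa using ih i (by simpa using hi)

theorem ReducedPath.tail {Γ : SerreGraph.{u}} {S : Set Γ.Dart} {a b : Γ.Vert} {d : Γ.Dart}
    {l : List Γ.Dart} (h : Γ.ReducedPath S b a (d :: l)) : Γ.ReducedPath S b (Γ.tgt d) l := by
  cases h with
  | cons _ _ _ h _ => exact h

/-- The path is built from its end; a dart that would be followed by its inverse is cancelled
against it. -/
theorem exists_reducedPath {Γ : SerreGraph.{u}} {S : Set Γ.Dart} {a b : Γ.Vert}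
    (h : Relation.ReflTransGen (fun x y => ∃ d ∈ S, Γ.src d = x ∧ Γ.tgt d = y) a b) :
    ∃ l, Γ.ReducedPath S b a l := by
  induction h using Relation.ReflTransGen.head_induction_on with
  | refl => exact ⟨[], .nil⟩
  | head hxy _ ih =>
    obtain ⟨d, hd, rfl, rfl⟩ := hxy
    obtain ⟨l, hl⟩ := ih
    by_cases hh : ∀ d' ∈ l.head?, d' ≠ Γ.inv d
    · exact ⟨_, .cons d l hd hl hh⟩
    · push Not at hh
      obtain ⟨d', hd', rfl⟩ := hh
      cases l with
      | nil => simp at hd'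
      | cons d₁ l₁ =>
        simp only [List.head?_cons, Option.mem_def, Option.some.injEq] at hd'
        subst hd'
        refine ⟨l₁, ?_⟩
        simpa [tgt, Γ.inv_inv] using hl.tail

/-- If the endpoints of an edge in `S` are joined in `S` by a path that avoids this edge, then the
edge lies on a reduced cycle in `S`. -/
theorem exists_reduced_cycle {Γ : SerreGraph.{u}} {S : Set Γ.Dart} {e : Γ.Dart} (he : e ∈ S)
    (h : Relation.ReflTransGen
      (fun x y => ∃ d ∈ S \ {e, Γ.inv e}, Γ.src d = x ∧ Γ.tgt d = y) (Γ.tgt e) (Γ.src e)) :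
    ∃ (n : ℕ) (_ : NeZero n) (p : ZMod n → Γ.Dart),
      (∀ i, p i ∈ S) ∧ Γ.IsClosedPath p ∧ Γ.IsReduced p ∧ ∃ i, p i = e := by
  obtain ⟨l, hl⟩ := exists_reducedPath h
  have hmem := hl.mem
  have hm : Γ.ReducedPath S (Γ.src e) (Γ.src e) (e :: l) := by
    refine .cons e l he (hl.mono Set.sdiff_subset) ?_
    intro d' hd' hc
    have := hmem d' (List.mem_of_mem_head? hd')
    simp [hc] at this
  -- This is reducedness at the place where the cycle closes up: `l` avoids the inverse of `e`.
  have hlast : ∀ d ∈ (e :: l).getLast?, e ≠ Γ.inv d := by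
    intro d hd hc
    have hd := List.mem_of_mem_getLast? hd
    rcases List.mem_cons.1 hd with rfl | hd
    · exact Γ.inv_ne _ hc.symm
    · have := hmem d hd
      rw [hc, Γ.inv_inv] at this
      simp at this
  -- `ZMod (n + 1)` unfolds to `Fin (n + 1)`, so the list is read as a cyclic path, with wrap-around
  -- at `Fin.last`.
  have key : ∀ i : Fin (l.length + 1),
      Γ.tgt ((e :: l).get i) = Γ.src ((e :: l).get (i + 1)) ∧
        (e :: l).get (i + 1) ≠ Γ.inv ((e :: l).get i) := by
    intro i
    by_cases hi : i = Fin.last _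
    · subst hi
      have h1 : (e :: l).get (Fin.last l.length) ∈ (e :: l).getLast? := by
        simp [List.getLast?_eq_getElem?]
      rw [Fin.last_add_one]
      exact ⟨hm.tgt_last _ h1, hlast _ h1⟩
    · have hi' : i.val + 1 < (e :: l).length := by
        have := Fin.val_lt_last hi
        simpa using this
      have h2 : i + 1 = ⟨i.val + 1, hi'⟩ := by
        ext
        exact Fin.val_add_one_of_lt (Fin.lt_last_iff_ne_last.2 hi)
      rw [h2]
      exact hm.step i.val hi'
  refine ⟨l.length + 1, inferInstance, (e :: l).get, ?_, fun i => (key i).1, fun i => (key i).2,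
    (0 : Fin (l.length + 1)), rfl⟩
  intro i
  exact hm.mem _ (List.get_mem _ _)

/-- The form in which the forest condition is used: an edge outside of `Λ'` is a bridge of `Λ`. -/
theorem Subgraph.IsForestRel.not_joined {Γ : SerreGraph.{u}} {Λ Λ' : Γ.Subgraph}
    (h : Λ.IsForestRel Λ') {e : Γ.Dart} (he : e ∈ Λ.darts) (he' : e ∉ Λ'.darts) :
    ¬ Relation.ReflTransGen
      (fun x y => ∃ d ∈ Λ.darts \ {e, Γ.inv e}, Γ.src d = x ∧ Γ.tgt d = y)
        (Γ.tgt e) (Γ.src e) := by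
  intro hc
  obtain ⟨n, hn, p, h1, h2, h3, i, rfl⟩ := exists_reduced_cycle he hc
  exact he' (h n p h1 h2 h3 i)

end SerreGraph

/-! ### Darts, edges and signs -/

namespace SerreGraph

theorem src_inv (Γ : SerreGraph.{u}) (d : Γ.Dart) : Γ.src (Γ.inv d) = Γ.tgt d := rfl

theorem tgt_inv (Γ : SerreGraph.{u}) (d : Γ.Dart) : Γ.tgt (Γ.inv d) = Γ.src d := by
  simp [tgt, Γ.inv_inv]

theorem inv_injective (Γ : SerreGraph.{u}) : Function.Injective Γ.inv :=
  Function.LeftInverse.injective Γ.inv_inv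

theorem inv_eq_iff (Γ : SerreGraph.{u}) {d e : Γ.Dart} : Γ.inv d = e ↔ d = Γ.inv e := by
  constructor <;> rintro rfl <;> simp [Γ.inv_inv]

theorem natCard_dart (Γ : SerreGraph.{u}) [Finite Γ.Dart] :
    Nat.card Γ.Dart = 2 * Nat.card Γ.Edge := by
  let r : Γ.Edge → Γ.Dart := fun e => e.2.choose
  have hr : ∀ e : Γ.Edge, e.1 = s(r e, Γ.inv (r e)) := fun e => e.2.choose_spec
  let F : Γ.Edge × Bool → Γ.Dart := fun x => if x.2 then r x.1 else Γ.inv (r x.1)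
  have hF : ∀ x, x.1.1 = s(F x, Γ.inv (F x)) := by
    rintro ⟨e, _ | _⟩
    · simp [F, Γ.inv_inv, hr e, Sym2.eq_swap]
    · simp [F, hr e]
  have hb : Function.Bijective F := by
    constructor
    · intro x y hxy
      have h1 : x.1 = y.1 := Subtype.ext (by rw [hF x, hF y, hxy])
      obtain ⟨e, b⟩ := x
      obtain ⟨e', b'⟩ := y
      obtain rfl : e = e' := h1
      cases b <;> cases b' <;> simp [F] at hxy ⊢
      · exact Γ.inv_ne _ hxy
      · exact Γ.inv_ne _ hxy.symm
    · intro d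
      have h1 := hr ⟨s(d, Γ.inv d), d, rfl⟩
      rcases Sym2.eq_iff.1 h1 with ⟨h, -⟩ | ⟨h, -⟩
      · exact ⟨(⟨s(d, Γ.inv d), d, rfl⟩, true), by simp [F, ← h]⟩
      · refine ⟨(⟨s(d, Γ.inv d), d, rfl⟩, false), ?_⟩
        simp only [F, Bool.false_eq_true, if_false]
        exact h.symm
  rw [← Nat.card_eq_of_bijective F hb, Nat.card_prod, Nat.card_eq_fintype_card (α := Bool),
    Fintype.card_bool, mul_comm]

open Classical in
/-- The contribution of a dart to exponent sums. -/
noncomputable def Orientation.sgn {Γ : SerreGraph.{u}} (o : Γ.Orientation) (d : Γ.Dart) : ℤ :=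
  if o.pos d then 1 else -1

theorem Orientation.sgn_inv {Γ : SerreGraph.{u}} (o : Γ.Orientation) (d : Γ.Dart) :
    o.sgn (Γ.inv d) = - o.sgn d := by
  by_cases h : o.pos d <;> simp [sgn, o.pos_inv, h]

theorem Orientation.expSum_eq {Γ : SerreGraph.{u}} (o : Γ.Orientation) {n : ℕ} [NeZero n]
    (p : ZMod n → Γ.Dart) : o.expSum p = ∑ i, o.sgn (p i) := rfl

end SerreGraph

theorem ZMod.induction_succ {n : ℕ} [NeZero n] {P : ZMod n → Prop} (i : ZMod n) (h0 : P i)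
    (h : ∀ j, P j → P (j + 1)) (j : ZMod n) : P j := by
  have : ∀ k : ℕ, P (i + k) := by
    intro k
    induction k with
    | zero => simpa using h0
    | succ k ih => simpa [add_assoc] using h _ ih
  have h1 := this (j - i).val
  rw [ZMod.natCast_zmod_val] at h1
  simpa using h1

/-! ### Subcomplexes and their collapses -/

namespace TwoComplex

/-- Twice the Euler characteristic, for a subcomplex. -/
noncomputable def Subcomplex.chi2 {X : TwoComplex.{u}} (Z : X.Subcomplex) : ℤ :=
  2 * Z.verts.ncard - Z.darts.ncard + 2 * Z.faces.ncard

/-- There is an edge path in `Z` from `a` to `b`. -/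
def Subcomplex.Joined {X : TwoComplex.{u}} (Z : X.Subcomplex) (a b : X.Vert) : Prop :=
  Relation.ReflTransGen (fun x y => ∃ d ∈ Z.darts, X.src d = x ∧ X.tgt d = y) a b

theorem Subcomplex.Joined.symm {X : TwoComplex.{u}} {Z : X.Subcomplex} {a b : X.Vert}
    (h : Z.Joined a b) : Z.Joined b a := by
  induction h with
  | refl => exact .refl
  | tail _ hxy ih =>
    obtain ⟨d, hd, rfl, rfl⟩ := hxy
    exact .head ⟨X.inv d, Z.inv_mem d hd, rfl, X.tgt_inv d⟩ ih

theorem Subcomplex.Joined.of_dart {X : TwoComplex.{u}} {Z : X.Subcomplex} {d : X.Dart}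
    (hd : d ∈ Z.darts) : Z.Joined (X.src d) (X.tgt d) :=
  .single ⟨d, hd, rfl, rfl⟩

def Subcomplex.Conn {X : TwoComplex.{u}} (Z : X.Subcomplex) : Prop :=
  Z.verts.Nonempty ∧ ∀ a ∈ Z.verts, ∀ b ∈ Z.verts, Z.Joined a b

/-- The edge of `d` is a free edge of the subcomplex. -/
def Subcomplex.IsFreeEdge {X : TwoComplex.{u}} (Z : X.Subcomplex) (d : X.Dart) : Prop :=
  ∃! s : Σ f : X.Face, ZMod (X.len f), s.1 ∈ Z.faces ∧ (X.bd s.1 s.2 = d ∨ X.bd s.1 s.2 = X.inv d)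

/-- `v` is a free vertex of the subcomplex. -/
def Subcomplex.IsFreeVert {X : TwoComplex.{u}} (Z : X.Subcomplex) (v : X.Vert) : Prop :=
  ∃ d ∈ Z.darts, X.src d = v ∧ (∀ d' ∈ Z.darts, X.src d' = v → d' = d) ∧
    ∀ f ∈ Z.faces, ∀ i, X.bd f i ≠ d ∧ X.bd f i ≠ X.inv d

/-- A height function: along every edge the height changes by one, as the direction says. -/
def Subcomplex.IsHeight {X : TwoComplex.{u}} (Z : X.Subcomplex) (o : X.Orientation)
    (h : X.Vert → ℤ) : Prop :=
  ∀ d ∈ Z.darts, h (X.tgt d) = h (X.src d) + o.sgn d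

def Subcomplex.Le {X : TwoComplex.{u}} (Z Y : X.Subcomplex) : Prop :=
  Z.verts ⊆ Y.verts ∧ Z.darts ⊆ Y.darts ∧ Z.faces ⊆ Y.faces

/-- The result of collapsing the face `f` across the free edge of `d`. -/
def Subcomplex.collapseEdge {X : TwoComplex.{u}} (Z : X.Subcomplex) (d : X.Dart) (f : X.Face)
    (hf : ∀ g ∈ Z.faces, g ≠ f → ∀ i, X.bd g i ≠ d ∧ X.bd g i ≠ X.inv d) : X.Subcomplex where
  verts := Z.verts
  darts := Z.darts \ {d, X.inv d}
  faces := Z.faces \ {f}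
  src_mem e he := Z.src_mem e he.1
  inv_mem e he := by
    refine ⟨Z.inv_mem e he.1, ?_⟩
    have h2 := he.2
    simp only [Set.mem_insert_iff, Set.mem_singleton_iff, not_or] at h2 ⊢
    exact ⟨fun h => h2.2 (X.inv_eq_iff.1 h), fun h => h2.1 (X.inv_injective h)⟩
  bd_mem g hg i := by
    refine ⟨Z.bd_mem g hg.1 i, ?_⟩
    simpa using hf g hg.1 hg.2 i

/-- The result of collapsing the edge of `d` from the free vertex at which `d` starts. -/
def Subcomplex.collapseVert {X : TwoComplex.{u}} (Z : X.Subcomplex) (d : X.Dart)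
    (hd : ∀ d' ∈ Z.darts, X.src d' = X.src d → d' = d)
    (hf : ∀ f ∈ Z.faces, ∀ i, X.bd f i ≠ d ∧ X.bd f i ≠ X.inv d) : X.Subcomplex where
  verts := Z.verts \ {X.src d}
  darts := Z.darts \ {d, X.inv d}
  faces := Z.faces
  src_mem e he := by
    refine ⟨Z.src_mem e he.1, fun h => he.2 ?_⟩
    simp [hd e he.1 h]
  inv_mem e he := by
    refine ⟨Z.inv_mem e he.1, ?_⟩
    have h2 := he.2
    simp only [Set.mem_insert_iff, Set.mem_singleton_iff, not_or] at h2 ⊢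
    exact ⟨fun h => h2.2 (X.inv_eq_iff.1 h), fun h => h2.1 (X.inv_injective h)⟩
  bd_mem g hg i := by
    refine ⟨Z.bd_mem g hg i, ?_⟩
    simpa using hf g hg i

theorem ncard_sdiff_dart {X : TwoComplex.{u}} (hX : X.IsFinite) (Z : X.Subcomplex) {d : X.Dart}
    (hd : d ∈ Z.darts) : (Z.darts \ {d, X.inv d}).ncard + 2 = Z.darts.ncard := by
  have := hX.2.1
  have h1 := Set.ncard_sdiff_add_ncard_of_subset (s := {d, X.inv d}) (t := Z.darts)
    (by rintro e (rfl | rfl); exacts [hd, Z.inv_mem _ hd])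
  rwa [Set.ncard_pair (X.inv_ne d).symm] at h1

theorem ncard_sdiff_one {α : Type*} [Finite α] (S : Set α) {a : α} (ha : a ∈ S) :
    (S \ {a}).ncard + 1 = S.ncard := Set.ncard_sdiff_singleton_add_one ha

/-- The remaining sides of a face join the endpoints of one side. -/
theorem Subcomplex.joined_of_sides {X : TwoComplex.{u}} (Z : X.Subcomplex) (f : X.Face)
    (i : ZMod (X.len f)) (h : ∀ j, j ≠ i → X.bd f j ∈ Z.darts) :
    Z.Joined (X.tgt (X.bd f i)) (X.src (X.bd f i)) := by
  have key : ∀ k : ℕ, k + 1 ≤ X.len f →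
      Z.Joined (X.tgt (X.bd f i)) (X.src (X.bd f (i + ((k + 1 : ℕ) : ZMod (X.len f))))) := by
    intro k
    induction k with
    | zero =>
      intro _
      have := X.bd_closed f i
      rw [this]
      simp only [zero_add, Nat.cast_one]
      exact .refl
    | succ k ih =>
      intro hk
      refine (ih (by omega)).tail ⟨X.bd f (i + ((k + 1 : ℕ) : ZMod (X.len f))), h _ ?_, rfl, ?_⟩
      · intro hc
        have hc : (((k + 1 : ℕ)) : ZMod (X.len f)) = 0 := by simpa using hc
        rw [ZMod.natCast_eq_zero_iff] at hc
        have := Nat.le_of_dvd (by omega) hc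
        omega
      · have := X.bd_closed f (i + ((k + 1 : ℕ) : ZMod (X.len f)))
        rw [this]
        push_cast
        ring_nf
  have h0 := (X.len_ne f).out
  have := key (X.len f - 1) (by omega)
  rw [show X.len f - 1 + 1 = X.len f by omega] at this
  simpa using this

/-- The other sides of `f` survive the collapse and replace the removed edge in every path. -/
theorem Subcomplex.conn_collapseEdge {X : TwoComplex.{u}} {Z : X.Subcomplex} (hZ : Z.Conn)
    {d : X.Dart} {f : X.Face} {i : ZMod (X.len f)} (hfZ : f ∈ Z.faces)
    (hi : X.bd f i = d ∨ X.bd f i = X.inv d)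
    (hi' : ∀ j, j ≠ i → X.bd f j ≠ d ∧ X.bd f j ≠ X.inv d)
    (hf : ∀ g ∈ Z.faces, g ≠ f → ∀ i, X.bd g i ≠ d ∧ X.bd g i ≠ X.inv d) :
    (Z.collapseEdge d f hf).Conn := by
  refine ⟨hZ.1, fun a ha b hb => ?_⟩
  have h1 : (Z.collapseEdge d f hf).Joined (X.tgt (X.bd f i)) (X.src (X.bd f i)) :=
    (Z.collapseEdge d f hf).joined_of_sides f i fun j hj =>
      ⟨Z.bd_mem f hfZ j, by simpa using hi' j hj⟩
  have h2 : (Z.collapseEdge d f hf).Joined (X.src d) (X.tgt d) := by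
    rcases hi with h | h
    · rw [h] at h1
      exact h1.symm
    · rw [h, X.tgt_inv] at h1
      exact h1
  have h := hZ.2 a ha b hb
  clear ha hb
  induction h with
  | refl => exact .refl
  | tail _ hxy ih =>
    refine ih.trans ?_
    obtain ⟨e, he, rfl, rfl⟩ := hxy
    by_cases h3 : e = d
    · exact h3 ▸ h2
    · by_cases h4 : e = X.inv d
      · rw [h4, X.tgt_inv]
        exact h2.symm
      · exact Joined.of_dart (Z := Z.collapseEdge d f hf) ⟨he, by simp [h3, h4]⟩

theorem Subcomplex.conn_collapseVert {X : TwoComplex.{u}} {Z : X.Subcomplex} (hZ : Z.Conn)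
    {d : X.Dart} (hdZ : d ∈ Z.darts) (hd : ∀ d' ∈ Z.darts, X.src d' = X.src d → d' = d)
    (hf : ∀ f ∈ Z.faces, ∀ i, X.bd f i ≠ d ∧ X.bd f i ≠ X.inv d) :
    (Z.collapseVert d hd hf).Conn := by
  classical
  have hne : X.tgt d ≠ X.src d := fun h => X.inv_ne d (hd _ (Z.inv_mem _ hdZ) h)
  refine ⟨⟨X.tgt d, Z.src_mem _ (Z.inv_mem _ hdZ), hne⟩, fun a ha b hb => ?_⟩
  -- The retraction that pushes the free vertex to the other end of its edge; it turns paths in `Z`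
  -- into paths in the collapsed complex.
  let r : X.Vert → X.Vert := fun x => if x = X.src d then X.tgt d else x
  have key : (Z.collapseVert d hd hf).Joined (r a) (r b) := by
    have h := hZ.2 a ha.1 b hb.1
    clear ha hb
    induction h with
    | refl => exact .refl
    | tail _ hxy ih =>
      refine ih.trans ?_
      obtain ⟨e, he, rfl, rfl⟩ := hxy
      by_cases h3 : e = d
      · subst h3
        simp only [r, if_true, if_neg hne]
        exact .refl
      · by_cases h4 : e = X.inv d
        · subst h4
          simp only [r, X.tgt_inv, X.src_inv, if_true, if_neg hne]
          exact .refl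
        · have h5 : X.src e ≠ X.src d := fun h => h3 (hd e he h)
          have h6 : X.tgt e ≠ X.src d := fun h =>
            h4 (X.inv_eq_iff.1 (hd _ (Z.inv_mem _ he) h))
          simp only [r, if_neg h5, if_neg h6]
          exact Joined.of_dart (Z := Z.collapseVert d hd hf) ⟨he, by simp [h3, h4]⟩
  have h1 : r a = a := if_neg ha.2
  have h2 : r b = b := if_neg hb.2
  rwa [h1, h2] at key

theorem Subcomplex.IsHeight.of_inv {X : TwoComplex.{u}} {o : X.Orientation} {h : X.Vert → ℤ}
    {d : X.Dart} (hd : h (X.tgt d) = h (X.src d) + o.sgn d) :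
    h (X.tgt (X.inv d)) = h (X.src (X.inv d)) + o.sgn (X.inv d) := by
  rw [X.tgt_inv, X.src_inv, o.sgn_inv, hd]
  ring

/-- Around the boundary the height differences telescope to zero and so do the signs, so a defect
cannot occur at a single side. -/
theorem height_of_sides {X : TwoComplex.{u}} {o : X.Orientation} {h : X.Vert → ℤ} (f : X.Face)
    (hf : o.expSum (X.bd f) = 0) (i : ZMod (X.len f))
    (hi : ∀ j, j ≠ i → h (X.tgt (X.bd f j)) = h (X.src (X.bd f j)) + o.sgn (X.bd f j)) :
    h (X.tgt (X.bd f i)) = h (X.src (X.bd f i)) + o.sgn (X.bd f i) := by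
  have h1 : ∑ j, h (X.tgt (X.bd f j)) = ∑ j, h (X.src (X.bd f j)) := by
    rw [← Equiv.sum_comp (Equiv.addRight (1 : ZMod (X.len f))) (fun j => h (X.src (X.bd f j)))]
    exact Finset.sum_congr rfl fun j _ => congrArg h (X.bd_closed f j)
  have h2 : ∑ j, (h (X.tgt (X.bd f j)) - h (X.src (X.bd f j)) - o.sgn (X.bd f j)) = 0 := by
    rw [Finset.sum_sub_distrib, Finset.sum_sub_distrib, h1, ← o.expSum_eq, hf]
    ring
  rw [Finset.sum_eq_single i (fun j _ hj => by rw [hi j hj]; ring) (by simp)] at h2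
  linarith

/-- A connected subcomplex with positive Euler characteristic is collapsible: it has Euler
characteristic one and carries a height function. Unless it is a point it can be collapsed
relatively to any of its vertices. -/
theorem Subcomplex.collapsible {X : TwoComplex.{u}} (hX : X.IsFinite) {o : X.Orientation}
    {Y : X.Subcomplex} (hY : ∀ f ∈ Y.faces, o.expSum (X.bd f) = 0)
    (hnpi : ∀ Z : X.Subcomplex, Z.Le Y → Z.Conn → (∀ v, ¬ Z.IsFreeVert v) →
      (∀ d, ¬ Z.IsFreeEdge d) → Z.chi2 ≤ 0 ∨ (∃ v, Z.verts = {v}) ∧ Z.darts = ∅) :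
    ∀ (n : ℕ) (Z : X.Subcomplex), Z.darts.ncard = n → Z.Le Y → Z.Conn →
      Z.chi2 ≤ 0 ∨ Z.chi2 = 2 ∧ (∃ h, Z.IsHeight o h) ∧
        ∀ v ∈ Z.verts, (Z.verts = {v} ∧ Z.darts = ∅) ∨ (∃ d, Z.IsFreeEdge d) ∨
          ∃ u, u ≠ v ∧ Z.IsFreeVert u := by
  have := hX.1
  have := hX.2.1
  have := hX.2.2
  intro n
  induction n using Nat.strong_induction_on with
  | _ n ih =>
  intro Z hn hZ hc
  by_cases hE : ∃ d, Z.IsFreeEdge d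
  · have hE0 := hE
    obtain ⟨d, ⟨f, i⟩, ⟨hf, hi⟩, huniq⟩ := hE
    have hd : d ∈ Z.darts := by
      rcases hi with h | h
      · exact h ▸ Z.bd_mem f hf i
      · have := Z.inv_mem _ (Z.bd_mem f hf i)
        rwa [h, X.inv_inv] at this
    have hi' : ∀ j, j ≠ i → X.bd f j ≠ d ∧ X.bd f j ≠ X.inv d := by
      intro j hj
      by_contra hcon
      have := huniq ⟨f, j⟩ ⟨hf, by tauto⟩
      simp at this
      exact hj this
    have hg : ∀ g ∈ Z.faces, g ≠ f → ∀ i, X.bd g i ≠ d ∧ X.bd g i ≠ X.inv d := by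
      intro g hg hgf j
      by_contra hcon
      have := huniq ⟨g, j⟩ ⟨hg, by tauto⟩
      exact hgf (congrArg Sigma.fst this)
    have hcard := ncard_sdiff_dart hX Z hd
    have hcardf := ncard_sdiff_one Z.faces hf
    have hchi : (Z.collapseEdge d f hg).chi2 = Z.chi2 := by
      simp only [chi2, collapseEdge]
      rw [← hcard, ← hcardf]
      push_cast
      ring
    rcases ih _ (hn ▸ hcard ▸ Nat.lt_add_of_pos_right two_pos) (Z.collapseEdge d f hg) rfl
      ⟨hZ.1, Set.sdiff_subset.trans hZ.2.1, Set.sdiff_subset.trans hZ.2.2⟩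
      (conn_collapseEdge hc hf hi hi' hg) with h | ⟨h1, ⟨h, hh⟩, -⟩
    · exact .inl (hchi ▸ h)
    · refine .inr ⟨hchi ▸ h1, ⟨h, ?_⟩, fun v _ => .inr (.inl hE0)⟩
      -- The height extends over the removed edge because the removed face has exponent sum zero.
      have h2 := height_of_sides f (hY f (hZ.2.2 hf)) i
        (fun j hj => hh _ ⟨Z.bd_mem f hf j, by simpa using hi' j hj⟩)
      have h3 : h (X.tgt d) = h (X.src d) + o.sgn d := by
        rcases hi with h4 | h4
        · rwa [h4] at h2
        · have := IsHeight.of_inv h2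
          rwa [h4, X.inv_inv] at this
      intro e he
      by_cases h4 : e = d
      · exact h4 ▸ h3
      by_cases h5 : e = X.inv d
      · exact h5 ▸ IsHeight.of_inv h3
      exact hh e ⟨he, by simp [h4, h5]⟩
  by_cases hV : ∃ u, Z.IsFreeVert u
  · obtain ⟨u, hu⟩ := hV
    have hu0 := hu
    obtain ⟨d, hd, rfl, hd', hf⟩ := hu
    have hne : X.tgt d ≠ X.src d := fun h => X.inv_ne d (hd' _ (Z.inv_mem _ hd) h)
    have hcard := ncard_sdiff_dart hX Z hd
    have hcardv := ncard_sdiff_one Z.verts (Z.src_mem d hd)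
    have hchi : (Z.collapseVert d hd' hf).chi2 = Z.chi2 := by
      simp only [chi2, collapseVert]
      rw [← hcard, ← hcardv]
      push_cast
      ring
    rcases ih _ (hn ▸ hcard ▸ Nat.lt_add_of_pos_right two_pos) (Z.collapseVert d hd' hf) rfl
      ⟨Set.sdiff_subset.trans hZ.1, Set.sdiff_subset.trans hZ.2.1, hZ.2.2⟩
      (conn_collapseVert hc hd hd' hf) with h | ⟨h1, ⟨h, hh⟩, h2⟩
    · exact .inl (hchi ▸ h)
    · refine .inr ⟨hchi ▸ h1, ?_, ?_⟩
      · classical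
        let h' : X.Vert → ℤ := Function.update h (X.src d) (h (X.tgt d) - o.sgn d)
        have h3 : h' (X.tgt d) = h' (X.src d) + o.sgn d := by
          simp [h', Function.update_of_ne hne]
        refine ⟨h', fun e he => ?_⟩
        by_cases h4 : e = d
        · exact h4 ▸ h3
        by_cases h5 : e = X.inv d
        · exact h5 ▸ IsHeight.of_inv h3
        have h6 : X.src e ≠ X.src d := fun h => h4 (hd' e he h)
        have h7 : X.tgt e ≠ X.src d := fun h =>
          h5 (X.inv_eq_iff.1 (hd' _ (Z.inv_mem _ he) h))
        simp only [h', Function.update_of_ne h6, Function.update_of_ne h7]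
        exact hh e ⟨he, by simp [h4, h5]⟩
      · intro v hv
        refine .inr ?_
        by_cases hvd : X.src d = v
        · subst hvd
          -- If `v` is itself the free vertex, the induction hypothesis is used relative to the
          -- other end of its edge: free cells found there are away from the collapsed edge and stay
          -- free. If only that end remains, it is the second free vertex of a segment.
          rcases h2 (X.tgt d) ⟨Z.src_mem _ (Z.inv_mem _ hd), hne⟩ with
            ⟨-, h3⟩ | ⟨e, h3⟩ | ⟨w, h3, e, he, rfl, h4, h5⟩
          · refine .inr ⟨X.tgt d, hne, X.inv d, Z.inv_mem _ hd, rfl, ?_, ?_⟩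
            · intro e he hed
              by_contra hcon
              have : e ∈ (Z.collapseVert d hd' hf).darts := by
                refine ⟨he, ?_⟩
                simp only [Set.mem_insert_iff, Set.mem_singleton_iff, not_or]
                refine ⟨?_, hcon⟩
                rintro rfl
                exact hne hed.symm
              rw [h3] at this
              exact this
            · intro f hfZ i
              rw [X.inv_inv]
              exact (hf f hfZ i).symm
          · exact .inl ⟨e, h3⟩
          · have h6 := (Z.collapseVert d hd' hf).src_mem e he
            refine .inr ⟨X.src e, h6.2, e, he.1, rfl, ?_, h5⟩
            intro e' he' hee
            refine h4 e' ⟨he', ?_⟩ hee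
            simp only [Set.mem_insert_iff, Set.mem_singleton_iff, not_or]
            constructor
            · rintro rfl
              exact h6.2 hee.symm
            · rintro rfl
              exact h3 hee.symm
        · exact .inr ⟨_, hvd, hu0⟩
  push Not at hE hV
  rcases hnpi Z hZ hc hV hE with h | ⟨⟨v, hv⟩, hd⟩
  · exact .inl h
  · have hfaces : Z.faces = ∅ := by
      rw [Set.eq_empty_iff_forall_notMem]
      intro f hf
      have := Z.bd_mem f hf 0
      rw [hd] at this
      exact this
    refine .inr ⟨by simp [chi2, hv, hd, hfaces], ⟨fun _ => 0, ?_⟩, ?_⟩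
    · intro e he
      rw [hd] at he
      exact he.elim
    · intro w hw
      rw [hv] at hw
      exact .inl ⟨hw ▸ hv, hd⟩

end TwoComplex

/-! ### Subcomplexes of the source and the hypothesis on K -/

namespace TwoComplex

theorem Subcomplex.two_mul_euler_toComplex {X : TwoComplex.{u}} (hX : X.IsFinite)
    (Z : X.Subcomplex) : 2 * Z.toComplex.euler = Z.chi2 := by
  have := hX.2.1
  have h : Nat.card Z.toComplex.Dart = 2 * Nat.card Z.toComplex.Edge := by
    have : Finite Z.toComplex.Dart := inferInstanceAs (Finite Z.darts)
    exact Z.toComplex.natCard_dart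
  have h1 : Nat.card Z.toComplex.Vert = Z.verts.ncard := Nat.card_coe_set_eq _
  have h2 : Nat.card Z.toComplex.Dart = Z.darts.ncard := Nat.card_coe_set_eq _
  have h3 : Nat.card Z.toComplex.Face = Z.faces.ncard := Nat.card_coe_set_eq _
  rw [euler, chi2, ← h1, ← h2, ← h3, h]
  push_cast
  ring

theorem two_mul_euler {X : TwoComplex.{u}} (hX : X.IsFinite) :
    2 * X.euler = 2 * Nat.card X.Vert - Nat.card X.Dart + 2 * Nat.card X.Face := by
  have := hX.2.1
  rw [euler, X.natCard_dart]
  push_cast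
  ring

theorem Subcomplex.Conn.toComplex {X : TwoComplex.{u}} {Z : X.Subcomplex} (hZ : Z.Conn) :
    Z.toComplex.IsConnected := by
  obtain ⟨⟨v, hv⟩, h⟩ := hZ
  refine ⟨⟨⟨v, hv⟩⟩, ?_⟩
  rintro ⟨a, ha⟩ ⟨b, hb⟩
  have hab := h a ha b hb
  clear h
  induction hab with
  | refl => exact .refl
  | tail _ hxy ih =>
    obtain ⟨d, hd, rfl, rfl⟩ := hxy
    exact (ih (Z.src_mem d hd)).tail ⟨⟨d, hd⟩, rfl, rfl⟩

theorem Subcomplex.IsFreeVert.of_toComplex {X : TwoComplex.{u}} {Z : X.Subcomplex}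
    {v : Z.toComplex.Vert} (h : Z.toComplex.IsFreeVert v) : Z.IsFreeVert v.1 := by
  obtain ⟨d, rfl, h1, h2⟩ := h
  refine ⟨d.1, d.2, rfl, fun d' hd' hs => ?_, fun f hf i => ?_⟩
  · exact congrArg Subtype.val (h1 ⟨d', hd'⟩ (Subtype.ext hs))
  · have := h2 ⟨f, hf⟩ i
    exact ⟨fun h => this.1 (Subtype.ext h), fun h => this.2 (Subtype.ext h)⟩

theorem Subcomplex.IsFreeEdge.of_toComplex {X : TwoComplex.{u}} {Z : X.Subcomplex}
    {d : Z.toComplex.Dart} (h : Z.toComplex.IsFreeEdge d) : Z.IsFreeEdge d.1 := by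
  obtain ⟨⟨⟨f, hf⟩, i⟩, h1, h2⟩ := h
  refine ⟨⟨f, i⟩, ⟨hf, ?_⟩, ?_⟩
  · rcases h1 with h1 | h1
    · exact .inl (congrArg Subtype.val h1)
    · exact .inr (congrArg Subtype.val h1)
  · rintro ⟨g, j⟩ ⟨hg, h3⟩
    have h4 := h2 ⟨⟨g, hg⟩, j⟩ (h3.imp (fun h => Subtype.ext h) (fun h => Subtype.ext h))
    have h5 := congrArg
      (fun s : Σ f : Z.toComplex.Face, ZMod (Z.toComplex.len f) =>
        (⟨s.1.1, s.2⟩ : Σ f : X.Face, ZMod (X.len f))) h4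
    exact h5

/-- The restriction of a combinatorial map to subcomplexes. -/
def Hom.restrict {X L : TwoComplex.{u}} (φ : X.Hom L) (Z : X.Subcomplex) (K : L.Subcomplex)
    (hv : ∀ v ∈ Z.verts, φ.onVert v ∈ K.verts) (hd : ∀ d ∈ Z.darts, φ.onDart d ∈ K.darts)
    (hf : ∀ f ∈ Z.faces, φ.onFace f ∈ K.faces) : Z.toComplex.Hom K.toComplex where
  onVert v := ⟨φ.onVert v.1, hv v.1 v.2⟩
  onDart d := ⟨φ.onDart d.1, hd d.1 d.2⟩
  onFace f := ⟨φ.onFace f.1, hf f.1 f.2⟩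
  flip f := φ.flip f.1
  onSide f := φ.onSide f.1
  src_onDart d := Subtype.ext (φ.src_onDart d.1)
  inv_onDart d := Subtype.ext (φ.inv_onDart d.1)
  onSide_of_not_flip f h i :=
    ⟨(φ.onSide_of_not_flip f.1 h i).1, Subtype.ext (φ.onSide_of_not_flip f.1 h i).2⟩
  onSide_of_flip f h i :=
    ⟨(φ.onSide_of_flip f.1 h i).1, Subtype.ext (φ.onSide_of_flip f.1 h i).2⟩

theorem Hom.IsImmersion.restrict {X L : TwoComplex.{u}} {φ : X.Hom L} (hφ : φ.IsImmersion)
    {Z : X.Subcomplex} {K : L.Subcomplex}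
    (hv : ∀ v ∈ Z.verts, φ.onVert v ∈ K.verts) (hd : ∀ d ∈ Z.darts, φ.onDart d ∈ K.darts)
    (hf : ∀ f ∈ Z.faces, φ.onFace f ∈ K.faces) : (φ.restrict Z K hv hd hf).IsImmersion := by
  constructor
  · intro d d' h1 h2
    exact Subtype.ext (hφ.1 d.1 d'.1 (congrArg Subtype.val h1) (congrArg Subtype.val h2))
  · rintro ⟨⟨f, hf'⟩, i⟩ ⟨⟨g, hg'⟩, j⟩ h1 h2
    have h3 := hφ.2 ⟨f, i⟩ ⟨g, j⟩ (congrArg Subtype.val h1)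
      (congrArg (fun c : K.toComplex.Corner => (⟨c.1.1, c.2⟩ : L.Corner)) h2)
    cases h3
    rfl

theorem Hom.chi2_nonpos_or_point {X L : TwoComplex.{u}} {φ : X.Hom L} (hφ : φ.IsImmersion)
    (hX : X.IsFinite) {K : L.Subcomplex} (hK : K.toComplex.CollapsingNPI) {Z : X.Subcomplex}
    (hv : ∀ v ∈ Z.verts, φ.onVert v ∈ K.verts) (hd : ∀ d ∈ Z.darts, φ.onDart d ∈ K.darts)
    (hf : ∀ f ∈ Z.faces, φ.onFace f ∈ K.faces) (hc : Z.Conn)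
    (h1 : ∀ v, ¬ Z.IsFreeVert v) (h2 : ∀ d, ¬ Z.IsFreeEdge d) :
    Z.chi2 ≤ 0 ∨ (∃ v, Z.verts = {v}) ∧ Z.darts = ∅ := by
  have hfin : Z.toComplex.IsFinite := by
    have := hX.1
    have := hX.2.1
    have := hX.2.2
    exact ⟨inferInstanceAs (Finite Z.verts), inferInstanceAs (Finite Z.darts),
      inferInstanceAs (Finite Z.faces)⟩
  rcases hK Z.toComplex (φ.restrict Z K hv hd hf) (hφ.restrict hv hd hf) hfin hc.toComplex
    (fun v h => h1 _ (Subcomplex.IsFreeVert.of_toComplex h))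
    (fun d h => h2 _ (Subcomplex.IsFreeEdge.of_toComplex h)) with h | ⟨h3, h4, -⟩
  · left
    rw [← Z.two_mul_euler_toComplex hX]
    linarith
  · right
    have h3 : Z.verts.ncard = 1 := (Nat.card_coe_set_eq _).symm.trans h3
    exact ⟨Set.ncard_eq_one.1 h3, Set.isEmpty_coe_sort.1 h4⟩

theorem Hom.onDart_bd {X L : TwoComplex.{u}} (φ : X.Hom L) (f : X.Face) (i : ZMod (X.len f)) :
    φ.onDart (X.bd f i) = L.bd (φ.onFace f) (φ.onSide f i) ∨
      φ.onDart (X.bd f i) = L.inv (L.bd (φ.onFace f) (φ.onSide f i)) := by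
  cases h : φ.flip f with
  | false => exact .inl (φ.onSide_of_not_flip f h i).2.symm
  | true =>
    refine .inr ?_
    rw [(φ.onSide_of_flip f h i).2, L.inv_inv]

/-- All vertices, together with the preimage of `K`. -/
def Hom.preimage {X L : TwoComplex.{u}} (φ : X.Hom L) (K : L.Subcomplex) : X.Subcomplex where
  verts := Set.univ
  darts := {d | φ.onDart d ∈ K.darts}
  faces := {f | φ.onFace f ∈ K.faces}
  src_mem _ _ := trivial
  inv_mem d hd := by
    change φ.onDart (X.inv d) ∈ K.darts
    rw [← φ.inv_onDart]
    exact K.inv_mem _ hd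
  bd_mem f hf i := by
    change φ.onDart (X.bd f i) ∈ K.darts
    rcases φ.onDart_bd f i with h | h
    · exact h ▸ K.bd_mem _ hf _
    · exact h ▸ K.inv_mem _ (K.bd_mem _ hf _)

/-- The preimage also contains vertices that are not mapped to `K`. A connected subcomplex with a
dart has none of these, and one without darts is a point. -/
theorem Hom.preimage_npi {X L : TwoComplex.{u}} {φ : X.Hom L} (hφ : φ.IsImmersion)
    (hX : X.IsFinite) {K : L.Subcomplex} (hK : K.toComplex.CollapsingNPI) {Z : X.Subcomplex}
    (hZ : Z.Le (φ.preimage K)) (hc : Z.Conn)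
    (h1 : ∀ v, ¬ Z.IsFreeVert v) (h2 : ∀ d, ¬ Z.IsFreeEdge d) :
    Z.chi2 ≤ 0 ∨ (∃ v, Z.verts = {v}) ∧ Z.darts = ∅ := by
  by_cases hd : Z.darts = ∅
  · refine .inr ⟨?_, hd⟩
    obtain ⟨⟨v, hv⟩, h⟩ := hc
    refine ⟨v, Set.eq_singleton_iff_unique_mem.2 ⟨hv, fun w hw => ?_⟩⟩
    have := h v hv w hw
    rcases Relation.ReflTransGen.cases_tail this with h | ⟨_, _, d, h, _⟩
    · exact h
    · rw [hd] at h
      exact h.elim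
  · obtain ⟨d, hd⟩ := Set.nonempty_iff_ne_empty.2 hd
    refine Hom.chi2_nonpos_or_point hφ hX hK ?_ hZ.2.1 hZ.2.2 hc h1 h2
    intro v hv
    rcases Relation.ReflTransGen.cases_tail (hc.2 _ (Z.src_mem d hd) v hv) with
      rfl | ⟨_, _, e, he, -, rfl⟩
    · rw [← φ.src_onDart]
      exact K.src_mem _ (hZ.2.1 hd)
    · rw [← X.src_inv, ← φ.src_onDart]
      exact K.src_mem _ (hZ.2.1 (Z.inv_mem e he))

/-! ### Corners -/

theorem Hom.ends_onCorner {X L : TwoComplex.{u}} (φ : X.Hom L) (c : X.Corner) :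
    (L.cornerFst (φ.onCorner c) = φ.onDart (X.cornerFst c) ∧
      L.cornerSnd (φ.onCorner c) = φ.onDart (X.cornerSnd c)) ∨
    (L.cornerFst (φ.onCorner c) = φ.onDart (X.cornerSnd c) ∧
      L.cornerSnd (φ.onCorner c) = φ.onDart (X.cornerFst c)) := by
  obtain ⟨f, i⟩ := c
  cases h : φ.flip f with
  | false =>
    left
    have h1 := φ.onSide_of_not_flip f h
    have h2 : φ.onCorner ⟨f, i⟩ = ⟨φ.onFace f, φ.onSide f i⟩ := by simp [onCorner, h]
    rw [h2]
    change L.inv (L.bd (φ.onFace f) (φ.onSide f i)) = φ.onDart (X.inv (X.bd f i)) ∧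
      L.bd (φ.onFace f) (φ.onSide f i + 1) = φ.onDart (X.bd f (i + 1))
    rw [← (h1 i).1, (h1 i).2, (h1 (i + 1)).2, φ.inv_onDart]
    exact ⟨rfl, rfl⟩
  | true =>
    right
    have h1 := φ.onSide_of_flip f h
    have h2 : φ.onCorner ⟨f, i⟩ = ⟨φ.onFace f, φ.onSide f (i + 1)⟩ := by simp [onCorner, h]
    rw [h2]
    change L.inv (L.bd (φ.onFace f) (φ.onSide f (i + 1))) = φ.onDart (X.bd f (i + 1)) ∧
      L.bd (φ.onFace f) (φ.onSide f (i + 1) + 1) = φ.onDart (X.inv (X.bd f i))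
    rw [(h1 (i + 1)).2, (h1 i).1, sub_add_cancel, (h1 i).2, L.inv_inv, φ.inv_onDart]
    exact ⟨rfl, rfl⟩

theorem Hom.sum_onCorner {X L : TwoComplex.{u}} (φ : X.Hom L) (ω : L.Corner → ℤ) (f : X.Face) :
    ∑ i, ω (φ.onCorner ⟨f, i⟩) = ∑ i, ω ⟨φ.onFace f, i⟩ := by
  cases h : φ.flip f with
  | false =>
    rw [← (φ.onSide f).sum_comp]
    simp [onCorner, h]
  | true =>
    rw [← (φ.onSide f).sum_comp,
      ← Equiv.sum_comp (Equiv.addRight (1 : ZMod (X.len f)))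
        (fun i => ω ⟨φ.onFace f, φ.onSide f i⟩)]
    simp [onCorner, h]

theorem Hom.len_onFace {X L : TwoComplex.{u}} (φ : X.Hom L) (f : X.Face) :
    L.len (φ.onFace f) = X.len f := by
  have := Fintype.card_congr (φ.onSide f)
  rw [ZMod.card, ZMod.card] at this
  exact this.symm

/-- The pullback of an orientation. -/
def Hom.orientation {X L : TwoComplex.{u}} (φ : X.Hom L) (o : L.Orientation) : X.Orientation where
  pos d := o.pos (φ.onDart d)
  pos_inv d := by
    rw [← φ.inv_onDart]
    exact o.pos_inv _

theorem Hom.expSum_orientation {X L : TwoComplex.{u}} (φ : X.Hom L) (o : L.Orientation)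
    (f : X.Face) (hf : o.expSum (L.bd (φ.onFace f)) = 0) :
    (φ.orientation o).expSum (X.bd f) = 0 := by
  rw [SerreGraph.Orientation.expSum_eq, ← (φ.onSide f).sum_comp] at hf
  rw [SerreGraph.Orientation.expSum_eq]
  have h0 : ∀ d, (φ.orientation o).sgn d = o.sgn (φ.onDart d) := fun d => rfl
  simp only [h0]
  cases h : φ.flip f with
  | false => simpa only [(φ.onSide_of_not_flip f h _).2] using hf
  | true =>
    simpa only [(φ.onSide_of_flip f h _).2, o.sgn_inv, Finset.sum_neg_distrib, neg_eq_zero]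
      using hf

/-! ### Joining darts in links -/

/-- The darts `x` and `y` are joined in the link of their common initial vertex by a path of corners
of angle zero that avoids the corners in `T`. -/
def LinkJoined (M : TwoComplex.{u}) (ω : M.Corner → ℤ) (T : Set M.Corner) (x y : M.Dart) : Prop :=
  Relation.ReflTransGen (fun x y => ∃ c, ω c = 0 ∧ c ∉ T ∧
    ((M.cornerFst c = x ∧ M.cornerSnd c = y) ∨ (M.cornerSnd c = x ∧ M.cornerFst c = y))) x y

theorem LinkJoined.symm {M : TwoComplex.{u}} {ω : M.Corner → ℤ} {T : Set M.Corner} {x y : M.Dart}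
    (h : M.LinkJoined ω T x y) : M.LinkJoined ω T y x := by
  induction h with
  | refl => exact .refl
  | tail _ hxy ih =>
    obtain ⟨c, h1, h2, h3⟩ := hxy
    exact .head ⟨c, h1, h2, h3.symm.imp And.symm And.symm⟩ ih

theorem LinkJoined.equivalence (M : TwoComplex.{u}) (ω : M.Corner → ℤ) (T : Set M.Corner) :
    Equivalence (M.LinkJoined ω T) :=
  ⟨fun _ => .refl, LinkJoined.symm, Relation.ReflTransGen.trans⟩

theorem LinkJoined.of_corner {M : TwoComplex.{u}} {ω : M.Corner → ℤ} {T : Set M.Corner}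
    {c : M.Corner} (h : ω c = 0) (hc : c ∉ T) :
    M.LinkJoined ω T (M.cornerFst c) (M.cornerSnd c) :=
  .single ⟨c, h, hc, .inl ⟨rfl, rfl⟩⟩

/-- `LinkJoined` speaks of darts and not of vertices of a fixed link, which avoids dependent types;
consecutive corners of such a path all sit at the same vertex. -/
theorem LinkJoined.lift {M : TwoComplex.{u}} {ω : M.Corner → ℤ} {T : Set M.Corner} {x y : M.Dart}
    {v : M.Vert} (hx : M.src x = v) (h : M.LinkJoined ω T x y) :
    ∃ hy : M.src y = v, Relation.ReflTransGen
      (fun a b => ∃ d ∈ ((Subcomplex.full M).lk0 ω v).darts \ {d | d.1.1 ∈ T},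
        (M.link v).src d = a ∧ (M.link v).tgt d = b) ⟨x, hx⟩ ⟨y, hy⟩ := by
  induction h with
  | refl => exact ⟨hx, .refl⟩
  | tail _ hxy ih =>
    obtain ⟨hy, ih⟩ := ih
    obtain ⟨c, h1, h2, ⟨rfl, rfl⟩ | ⟨rfl, rfl⟩⟩ := hxy
    · have hc : M.cornerVert c = v := hy
      exact ⟨(M.src_cornerSnd c).trans hc,
        ih.tail ⟨(⟨c, hc⟩, false), ⟨⟨trivial, h1⟩, h2⟩, rfl, rfl⟩⟩
    · have hc : M.cornerVert c = v := (M.src_cornerSnd c).symm.trans hy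
      exact ⟨hc, ih.tail ⟨(⟨c, hc⟩, true), ⟨⟨trivial, h1⟩, h2⟩, rfl, rfl⟩⟩

theorem LinkJoined.joined {M : TwoComplex.{u}} {ω : M.Corner → ℤ} {T : Set M.Corner}
    {x y : M.Dart} {v : M.Vert} (hx : M.src x = v) (hy : M.src y = v) (h : M.LinkJoined ω T x y) :
    ((Subcomplex.full M).lk0 ω v).Joined ⟨x, hx⟩ ⟨y, hy⟩ :=
  Relation.ReflTransGen.mono (fun _ _ ⟨d, hd, h⟩ => ⟨d, hd.1, h⟩) _ _ (h.lift hx).2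

/-- Such a corner is an edge of `lk0` of the whole complex outside `lk0` of `K`, hence a bridge. -/
theorem StrongRelColoringTest.not_linkJoined_of_zero {M : TwoComplex.{u}} {K : M.Subcomplex}
    {ω : M.Corner → ℤ} (h : M.StrongRelColoringTest K ω) {c : M.Corner} (hc : ω c = 0)
    (hcK : c.1 ∉ K.faces) : ¬ M.LinkJoined ω {c} (M.cornerFst c) (M.cornerSnd c) := by
  intro hj
  obtain ⟨_, hp⟩ := hj.symm.lift (M.src_cornerSnd c)
  refine (h.2.1 (M.cornerVert c)).1.not_joined (e := (⟨c, rfl⟩, false)) ⟨trivial, hc⟩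
    (fun hc => hcK hc.1) (Relation.ReflTransGen.mono ?_ _ _ hp)
  rintro _ _ ⟨d, ⟨h1, h2⟩, h3⟩
  refine ⟨d, ⟨h1, fun h4 => h2 ?_⟩, h3⟩
  rcases h4 with rfl | rfl <;> rfl

theorem StrongRelColoringTest.not_linkJoined_of_one {M : TwoComplex.{u}} {K : M.Subcomplex}
    {ω : M.Corner → ℤ} (h : M.StrongRelColoringTest K ω) {c : M.Corner} (hc : ω c = 1)
    (hcK : c.1 ∉ K.faces) : ¬ M.LinkJoined ω ∅ (M.cornerFst c) (M.cornerSnd c) :=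
  fun hj => hcK (h.2.2 (M.cornerVert c) ⟨c, rfl⟩ hc (hj.joined rfl (M.src_cornerSnd c)))

/-- Strongness moves the path into `lk0` of `K`, where a standard corner of angle 0 never changes
the sign. -/
theorem StrongRelColoringTest.pos_iff_of_linkJoined {M : TwoComplex.{u}} {K : M.Subcomplex}
    {o : M.Orientation} {ω : M.Corner → ℤ} (h : M.StrongRelColoringTest K ω)
    (hK : K.IsStandardOn o ω) {x y : M.Dart} (hx : x ∈ K.darts) (hy : y ∈ K.darts)
    (hxy : M.src x = M.src y) (hj : M.LinkJoined ω ∅ x y) : o.pos x ↔ o.pos y := by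
  have h1 := (h.2.1 (M.src x)).2 ⟨x, rfl⟩ hx ⟨y, hxy.symm⟩ hy (hj.joined rfl hxy.symm)
  have key : ∀ a b : (M.link (M.src x)).Vert, (K.lk0 ω (M.src x)).Joined a b →
      (o.pos a.1 ↔ o.pos b.1) := by
    intro a b hab
    induction hab with
    | refl => rfl
    | tail _ hxy ih =>
      obtain ⟨⟨c, b⟩, hd, rfl, rfl⟩ := hxy
      refine ih.trans ?_
      by_contra hcon
      have h2 : ¬ (o.pos (M.cornerFst c.1) ↔ o.pos (M.cornerSnd c.1)) := by
        cases b
        · exact hcon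
        · exact fun h => hcon h.symm
      have h3 := (hK c.1 hd.1).2 h2
      have h4 : ω c.1 = 0 := hd.2
      omega
  exact key _ _ h1

/-- In the maximal expansion any two darts of `K` with the same initial vertex span a corner. -/
theorem Subcomplex.exists_corner_maxExpansion {L : TwoComplex.{u}} (K : L.Subcomplex)
    (o : L.Orientation) {x y : L.Dart} (hx : x ∈ K.darts) (hy : y ∈ K.darts)
    (hxy : L.src x = L.src y) :
    ∃ c : (L.maxExpansion K o).Corner, c.1 ∈ (K.maxExpansion o).faces ∧
      (L.maxExpansion K o).cornerFst c = x ∧ (L.maxExpansion K o).cornerSnd c = y := by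
  -- The unreduced loop x⁻¹ y y⁻¹ x has exponent sum zero whatever the signs are, and its corner 0
  -- runs from `x` to `y`.
  let p : ZMod 4 → L.Dart := ![L.inv x, y, L.inv y, x]
  have hp : ∀ i, p i ∈ K.darts := by
    intro i
    change Fin 4 at i
    fin_cases i
    · exact K.inv_mem _ hx
    · exact hy
    · exact K.inv_mem _ hy
    · exact hx
  have hc : L.IsClosedPath p := by
    intro i
    change Fin 4 at i
    fin_cases i
    · exact (L.tgt_inv x).trans hxy
    · rfl
    · exact (L.tgt_inv y).trans hxy.symm
    · rfl
  have hs : o.expSum p = 0 := by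
    rw [o.expSum_eq]
    have : ∑ i, o.sgn (p i) = o.sgn (L.inv x) + o.sgn y + o.sgn (L.inv y) + o.sgn x :=
      Fin.sum_univ_four (fun i : Fin 4 => o.sgn (p i))
    rw [this, o.sgn_inv, o.sgn_inv]
    ring
  refine ⟨⟨Sum.inr ⟨4, p, hp, hc, hs⟩, (0 : ZMod 4)⟩, ?_, L.inv_inv x, rfl⟩
  intro f hf
  cases hf

end TwoComplex

/-! ### The forest of outside corners at a vertex -/

namespace TwoComplex

/-- Relations that witness that the corners of angle zero outside of `Y` form a forest, relatively
to the darts of `Y`: `J` relates darts that are joined by corners of angle zero, and `Jx c` relates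
darts that are joined by corners of angle zero other than `c`. -/
structure IsSeparated (X : TwoComplex.{u}) (Y : X.Subcomplex) (o : X.Orientation)
    (α : X.Corner → ℤ) (J : X.Dart → X.Dart → Prop) (Jx : X.Corner → X.Dart → X.Dart → Prop) :
    Prop where
  zero_or_one : ∀ c, α c = 0 ∨ α c = 1
  equiv : Equivalence J
  equiv_avoid : ∀ c, Equivalence (Jx c)
  corner : ∀ c, α c = 0 → J (X.cornerFst c) (X.cornerSnd c)
  corner_avoid : ∀ c c', c.1 ∉ Y.faces → X.cornerVert c = X.cornerVert c' → α c' = 0 → c' ≠ c →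
    Jx c (X.cornerFst c') (X.cornerSnd c')
  not_corner_avoid : ∀ c, c.1 ∉ Y.faces → α c = 0 → ¬ Jx c (X.cornerFst c) (X.cornerSnd c)
  not_corner : ∀ c, c.1 ∉ Y.faces → α c = 1 → ¬ J (X.cornerFst c) (X.cornerSnd c)
  same_sign : ∀ x ∈ Y.darts, ∀ y ∈ Y.darts, X.src x = X.src y → (o.pos x ↔ o.pos y) → J x y
  same_sign_avoid : ∀ c, c.1 ∉ Y.faces → ∀ x ∈ Y.darts, ∀ y ∈ Y.darts, X.src x = X.src y →
    (o.pos x ↔ o.pos y) → Jx c x y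
  sign_eq : ∀ x ∈ Y.darts, ∀ y ∈ Y.darts, X.src x = X.src y → J x y → (o.pos x ↔ o.pos y)

open Classical in
/-- Collapse the darts of `Y` to their signs. -/
noncomputable def signClass {X : TwoComplex.{u}} (Y : X.Subcomplex) (o : X.Orientation)
    (x : X.Dart) : X.Dart ⊕ Bool :=
  if x ∈ Y.darts then Sum.inr (decide (o.pos x)) else Sum.inl x

/-- The class of the dart `z` of the relation `R`, as a set of collapsed darts at `v`. -/
def signRel {X : TwoComplex.{u}} (Y : X.Subcomplex) (o : X.Orientation)
    (R : X.Dart → X.Dart → Prop) (v : X.Vert) (z : X.Dart) : X.Dart ⊕ Bool → Prop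
  | Sum.inl x => R x z
  | Sum.inr b => ∃ k ∈ Y.darts, X.src k = v ∧ (o.pos k ↔ b = true) ∧ R k z

/-- Darts of `Y` with the same sign at `v` are related, so classes of `R` survive the collapse of
darts to signs. -/
theorem signRel_signClass {X : TwoComplex.{u}} {Y : X.Subcomplex} {o : X.Orientation}
    {R : X.Dart → X.Dart → Prop} (hR : Equivalence R)
    (hs : ∀ x ∈ Y.darts, ∀ y ∈ Y.darts, X.src x = X.src y → (o.pos x ↔ o.pos y) → R x y)
    (z : X.Dart) {v : X.Vert} {x : X.Dart} (hx : X.src x = v) :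
    signRel Y o R v z (signClass Y o x) ↔ R x z := by
  classical
  by_cases hxY : x ∈ Y.darts
  · simp only [signClass, hxY, if_true, signRel, decide_eq_true_eq]
    constructor
    · rintro ⟨k, hk, hkv, hkx, h⟩
      exact hR.trans (hs x hxY k hk (hx.trans hkv.symm) hkx.symm) h
    · exact fun h => ⟨x, hxY, hx, Iff.rfl, h⟩
  · simp [signClass, hxY, signRel]

open Classical in
/-- The darts at `v` outside of `Y`. -/
noncomputable def outDarts {X : TwoComplex.{u}} [Fintype X.Dart] (Y : X.Subcomplex) (v : X.Vert) :
    Finset X.Dart :=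
  {d | X.src d = v ∧ d ∉ Y.darts}

open Classical in
/-- The corners at `v` of angle zero outside of `Y`. -/
noncomputable def outZeros {X : TwoComplex.{u}} [Fintype X.Face] (Y : X.Subcomplex)
    (α : X.Corner → ℤ) (v : X.Vert) : Finset X.Corner :=
  {c | X.cornerVert c = v ∧ c.1 ∉ Y.faces ∧ α c = 0}

theorem mem_outDarts {X : TwoComplex.{u}} [Fintype X.Dart] {Y : X.Subcomplex} {v : X.Vert}
    {d : X.Dart} : d ∈ outDarts Y v ↔ X.src d = v ∧ d ∉ Y.darts := by simp [outDarts]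

theorem mem_outZeros {X : TwoComplex.{u}} [Fintype X.Face] {Y : X.Subcomplex} {α : X.Corner → ℤ}
    {v : X.Vert} {c : X.Corner} :
    c ∈ outZeros Y α v ↔ X.cornerVert c = v ∧ c.1 ∉ Y.faces ∧ α c = 0 := by simp [outZeros]

/-- Some dart or corner at `v` is outside of `Y`. -/
def IsTouched {X : TwoComplex.{u}} (Y : X.Subcomplex) (v : X.Vert) : Prop :=
  (∃ d, X.src d = v ∧ d ∉ Y.darts) ∨ ∃ c : X.Corner, X.cornerVert c = v ∧ c.1 ∉ Y.faces

theorem signClass_mem {X : TwoComplex.{u}} [Fintype X.Dart] {Y : X.Subcomplex}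
    {o : X.Orientation} {v : X.Vert} {B : Finset Bool} {x : X.Dart} (hx : X.src x = v) (hB : ∀ b : Bool, x ∈ Y.darts → (o.pos x ↔ b = true) → b ∈ B) :
    signClass Y o x ∈ (outDarts Y v).disjSum B := by
  classical
  by_cases hxY : x ∈ Y.darts
  · simp only [signClass, hxY, if_true, Finset.inr_mem_disjSum]
    exact hB _ hxY (by simp)
  · simpa [signClass, hxY, mem_outDarts] using hx

/-- Together with `IsSeparated.signRel_iff` this provides the separating sets for the edge count:
what remains joined to the first end of `c` after `c` is deleted. -/
theorem IsSeparated.signRel_fst {X : TwoComplex.{u}} [Fintype X.Face] {Y : X.Subcomplex}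
    {o : X.Orientation} {α : X.Corner → ℤ} {J : X.Dart → X.Dart → Prop}
    {Jx : X.Corner → X.Dart → X.Dart → Prop} (h : IsSeparated X Y o α J Jx) {v : X.Vert} :
    ∀ c ∈ outZeros Y α v, signRel Y o (Jx c) v (X.cornerFst c) (signClass Y o (X.cornerFst c)) ∧
      ¬ signRel Y o (Jx c) v (X.cornerFst c) (signClass Y o (X.cornerSnd c)) := by
  intro c hc
  rw [mem_outZeros] at hc
  have hr := fun {x : X.Dart} (hx : X.src x = v) =>
    signRel_signClass (h.equiv_avoid c) (h.same_sign_avoid c hc.2.1) (X.cornerFst c) hx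
  exact ⟨(hr hc.1).2 ((h.equiv_avoid c).refl _), fun hn => h.not_corner_avoid c hc.2.1 hc.2.2
    ((h.equiv_avoid c).symm ((hr ((X.src_cornerSnd c).trans hc.1)).1 hn))⟩

theorem IsSeparated.signRel_iff {X : TwoComplex.{u}} [Fintype X.Face] {Y : X.Subcomplex}
    {o : X.Orientation} {α : X.Corner → ℤ} {J : X.Dart → X.Dart → Prop}
    {Jx : X.Corner → X.Dart → X.Dart → Prop} (h : IsSeparated X Y o α J Jx) {v : X.Vert} :
    ∀ c ∈ outZeros Y α v, ∀ c' ∈ outZeros Y α v, c' ≠ c →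
      (signRel Y o (Jx c) v (X.cornerFst c) (signClass Y o (X.cornerFst c')) ↔
        signRel Y o (Jx c) v (X.cornerFst c) (signClass Y o (X.cornerSnd c'))) := by
  intro c hc c' hc' hcc
  rw [mem_outZeros] at hc hc'
  have hr := fun {x : X.Dart} (hx : X.src x = v) =>
    signRel_signClass (h.equiv_avoid c) (h.same_sign_avoid c hc.2.1) (X.cornerFst c) hx
  have := h.corner_avoid c c' hc.2.1 (hc.1.trans hc'.1.symm) hc'.2.2 hcc
  refine (hr hc'.1).trans (Iff.trans ?_ (hr ((X.src_cornerSnd c').trans hc'.1)).symm)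
  exact ⟨(h.equiv_avoid c).trans ((h.equiv_avoid c).symm this), (h.equiv_avoid c).trans this⟩

/-- The signs of all darts of `Y` at corners at `v` outside of `Y` are in `B`. -/
def SignsIn {X : TwoComplex.{u}} (Y : X.Subcomplex) (o : X.Orientation) (v : X.Vert) (B : Finset Bool) : Prop :=
  ∀ c : X.Corner, X.cornerVert c = v → c.1 ∉ Y.faces → ∀ b : Bool,
    (X.cornerFst c ∈ Y.darts → (o.pos (X.cornerFst c) ↔ b = true) → b ∈ B) ∧
    (X.cornerSnd c ∈ Y.darts → (o.pos (X.cornerSnd c) ↔ b = true) → b ∈ B)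

theorem SignsIn.fst_mem {X : TwoComplex.{u}} [Fintype X.Dart] {Y : X.Subcomplex}
    {o : X.Orientation} {v : X.Vert} {B : Finset Bool} (hB : SignsIn Y o v B) {c : X.Corner}
    (h1 : X.cornerVert c = v) (h2 : c.1 ∉ Y.faces) :
    signClass Y o (X.cornerFst c) ∈ (outDarts Y v).disjSum B :=
  signClass_mem h1 fun b => (hB c h1 h2 b).1

theorem SignsIn.snd_mem {X : TwoComplex.{u}} [Fintype X.Dart] {Y : X.Subcomplex}
    {o : X.Orientation} {v : X.Vert} {B : Finset Bool} (hB : SignsIn Y o v B) {c : X.Corner}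
    (h1 : X.cornerVert c = v) (h2 : c.1 ∉ Y.faces) :
    signClass Y o (X.cornerSnd c) ∈ (outDarts Y v).disjSum B :=
  signClass_mem ((X.src_cornerSnd c).trans h1) fun b => (hB c h1 h2 b).2

section Local

variable {X : TwoComplex.{u}} [Fintype X.Dart] [Fintype X.Face]

variable {Y : X.Subcomplex} {o : X.Orientation} {α : X.Corner → ℤ}
  {J : X.Dart → X.Dart → Prop} {Jx : X.Corner → X.Dart → X.Dart → Prop}

theorem IsSeparated.card_add_one_le (h : IsSeparated X Y o α J Jx) {v : X.Vert}
    {B : Finset Bool} (hB : SignsIn Y o v B) (hne : ((outDarts Y v).disjSum B).Nonempty) :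
    (outZeros Y α v).card + 1 ≤ (outDarts Y v).card + B.card := by
  rw [← Finset.card_disjSum]
  refine card_add_one_le_of_separating _ _ _ _ ?_ ?_ _ h.signRel_fst h.signRel_iff hne
  · intro c hc
    rw [mem_outZeros] at hc
    exact hB.fst_mem hc.1 hc.2.1
  · intro c hc
    rw [mem_outZeros] at hc
    exact hB.snd_mem hc.1 hc.2.1

theorem IsSeparated.card_add_two_le (h : IsSeparated X Y o α J Jx) {v : X.Vert}
    {B : Finset Bool} (hB : SignsIn Y o v B) (P : X.Dart ⊕ Bool → Prop)
    (hP : ∀ c ∈ outZeros Y α v,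
      (P (signClass Y o (X.cornerFst c)) ↔ P (signClass Y o (X.cornerSnd c))))
    {x y : X.Dart ⊕ Bool} (hx : x ∈ (outDarts Y v).disjSum B)
    (hy : y ∈ (outDarts Y v).disjSum B) (hPx : P x) (hPy : ¬ P y) :
    (outZeros Y α v).card + 2 ≤ (outDarts Y v).card + B.card := by
  rw [← Finset.card_disjSum]
  refine card_add_two_le_of_separating _ _ _ _ ?_ ?_ _ h.signRel_fst h.signRel_iff P hP hx hy
    hPx hPy
  · intro c hc
    rw [mem_outZeros] at hc
    exact hB.fst_mem hc.1 hc.2.1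
  · intro c hc
    rw [mem_outZeros] at hc
    exact hB.snd_mem hc.1 hc.2.1

/-- Both signs are taken as vertices of the collapsed link, whether or not they occur. They lie in
different components, which pays for the two extra vertices. -/
theorem IsSeparated.card_outZeros_le (h : IsSeparated X Y o α J Jx) (v : X.Vert) :
    (outZeros Y α v).card ≤ (outDarts Y v).card := by
  classical
  have hB : SignsIn Y o v Finset.univ := fun c _ _ b => by simp
  -- `P` singles out what is joined to a positive dart of `Y`; by `sign_eq` a negative dart of `Y`
  -- never is.
  have key := h.card_add_two_le hB
    (P := fun a => match a with
      | Sum.inl x => ∃ k ∈ Y.darts, X.src k = v ∧ o.pos k ∧ J x k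
      | Sum.inr b => b = true)
    (x := Sum.inr true) (y := Sum.inr false) ?_ (by simp) (by simp) rfl (by simp)
  · simpa using key
  · have hP : ∀ x, X.src x = v → ((match signClass Y o x with
        | Sum.inl x => ∃ k ∈ Y.darts, X.src k = v ∧ o.pos k ∧ J x k
        | Sum.inr b => b = true) ↔ ∃ k ∈ Y.darts, X.src k = v ∧ o.pos k ∧ J x k) := by
      intro x hx
      by_cases hxY : x ∈ Y.darts
      · simp only [signClass, hxY, if_true, decide_eq_true_eq]
        constructor
        · exact fun hp => ⟨x, hxY, hx, hp, h.equiv.refl x⟩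
        · rintro ⟨k, hk, hkv, hkp, hxk⟩
          exact (h.sign_eq x hxY k hk (hx.trans hkv.symm) hxk).2 hkp
      · simp [signClass, hxY]
    intro c hc
    rw [mem_outZeros] at hc
    refine (hP _ hc.1).trans (Iff.trans ?_ (hP _ ((X.src_cornerSnd c).trans hc.1)).symm)
    have hJ := h.corner c hc.2.2
    constructor
    · rintro ⟨k, h1, h2, h3, h4⟩
      exact ⟨k, h1, h2, h3, h.equiv.trans (h.equiv.symm hJ) h4⟩
    · rintro ⟨k, h1, h2, h3, h4⟩
      exact ⟨k, h1, h2, h3, h.equiv.trans hJ h4⟩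

open Classical in
/-- In the absence of free edges, a dart outside of `Y` is not the end of exactly one corner. -/
theorem valence_ne_one {x : X.Dart} {v : X.Vert} (hx : x ∈ outDarts Y v)
    (hfree : ¬ X.IsFreeEdge x)
    (hzero : ∀ c : X.Corner, X.cornerVert c = v → c.1 ∉ Y.faces → α c = 0) :
    ({c ∈ outZeros Y α v | X.cornerFst c = x}).card +
      ({c ∈ outZeros Y α v | X.cornerSnd c = x}).card ≠ 1 := by
  rw [mem_outDarts] at hx
  obtain ⟨rfl, hxY⟩ := hx
  -- Each passage of a face over the edge of `x` yields one corner end at `x`: a first end if it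
  -- arrives along `X.inv x`, a second end if it leaves along `x`. So valence one would mean a free
  -- edge.
  have h1 : ∀ (f : X.Face) (i : ZMod (X.len f)), X.bd f i = X.inv x →
      (⟨f, i⟩ : X.Corner) ∈ ({c ∈ outZeros Y α (X.src x) | X.cornerFst c = x} : Finset _) := by
    intro f i hi
    have h2 : X.cornerFst ⟨f, i⟩ = x := by
      change X.inv (X.bd f i) = x
      rw [hi, X.inv_inv]
    have h3 : X.cornerVert ⟨f, i⟩ = X.src x := by rw [← X.src_cornerFst, h2]
    have h4 : f ∉ Y.faces := fun hf => hxY (by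
      have := Y.inv_mem _ (Y.bd_mem f hf i)
      rwa [hi, X.inv_inv] at this)
    rw [Finset.mem_filter, mem_outZeros]
    exact ⟨⟨h3, h4, hzero _ h3 h4⟩, h2⟩
  have h2 : ∀ (f : X.Face) (i : ZMod (X.len f)), X.bd f i = x →
      (⟨f, i - 1⟩ : X.Corner) ∈ ({c ∈ outZeros Y α (X.src x) | X.cornerSnd c = x} : Finset _) := by
    intro f i hi
    have h2 : X.cornerSnd ⟨f, i - 1⟩ = x := by
      change X.bd f (i - 1 + 1) = x
      rw [sub_add_cancel, hi]
    have h3 : X.cornerVert ⟨f, i - 1⟩ = X.src x := by rw [← X.src_cornerSnd, h2]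
    have h4 : f ∉ Y.faces := fun hf => hxY (hi ▸ Y.bd_mem f hf i)
    rw [Finset.mem_filter, mem_outZeros]
    exact ⟨⟨h3, h4, hzero _ h3 h4⟩, h2⟩
  intro hone
  apply hfree
  rcases Nat.add_eq_one_iff.1 hone with ⟨ha, hb⟩ | ⟨ha, hb⟩
  · rw [Finset.card_eq_zero, Finset.eq_empty_iff_forall_notMem] at ha
    obtain ⟨⟨f, i⟩, hc⟩ := Finset.card_eq_one.1 hb
    have hm : (⟨f, i⟩ : X.Corner) ∈ ({c ∈ outZeros Y α (X.src x) | X.cornerSnd c = x} :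
      Finset _) := by rw [hc]; simp
    refine ⟨⟨f, i + 1⟩, .inl (Finset.mem_filter.1 hm).2, ?_⟩
    rintro ⟨g, j⟩ (hj | hj)
    · have := h2 g j hj
      rw [hc, Finset.mem_singleton] at this
      cases this
      simp
    · exact absurd (h1 g j hj) (ha _)
  · rw [Finset.card_eq_zero, Finset.eq_empty_iff_forall_notMem] at hb
    obtain ⟨⟨f, i⟩, hc⟩ := Finset.card_eq_one.1 ha
    have hm : (⟨f, i⟩ : X.Corner) ∈ ({c ∈ outZeros Y α (X.src x) | X.cornerFst c = x} :
      Finset _) := by rw [hc]; simp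
    refine ⟨⟨f, i⟩, .inr (X.inv_eq_iff.1 (Finset.mem_filter.1 hm).2), ?_⟩
    rintro ⟨g, j⟩ (hj | hj)
    · exact absurd (h2 g j hj) (hb _)
    · have := h1 g j hj
      rwa [hc, Finset.mem_singleton] at this

/-- At a vertex `v` that meets cells outside of `Y`, there are more darts than corners of angle
zero outside of `Y`, if the darts of `Y` that are met have the same sign. -/
theorem IsSeparated.card_outZeros_lt (h : IsSeparated X Y o α J Jx)
    (hfree : ∀ d, ¬ X.IsFreeEdge d) {v : X.Vert} {B : Finset Bool} (hB : SignsIn Y o v B)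
    (hB1 : B.card ≤ 1)
    (ht : IsTouched Y v) :
    (outZeros Y α v).card + 2 ≤ (outDarts Y v).card + B.card ∨
      B = ∅ ∧ (∃ d, outDarts Y v = {d}) ∧ ∀ c : X.Corner, X.cornerVert c = v → c.1 ∈ Y.faces := by
  classical
  by_cases hzero : ∀ c : X.Corner, X.cornerVert c = v → c.1 ∉ Y.faces → α c = 0
  swap
  · left
    push Not at hzero
    obtain ⟨c, h1, h2, h3⟩ := hzero
    have h3 := (h.zero_or_one c).resolve_left h3
    have hr := fun {x : X.Dart} (hx : X.src x = v) =>
      signRel_signClass h.equiv h.same_sign (X.cornerFst c) hx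
    -- The ends of an outside corner of angle 1 lie in different components.
    refine h.card_add_two_le hB (signRel Y o J v (X.cornerFst c)) ?_ (hB.fst_mem h1 h2)
      (hB.snd_mem h1 h2)
      ((hr h1).2 (h.equiv.refl _))
      (fun hn => h.not_corner c h2 h3 (h.equiv.symm ((hr ((X.src_cornerSnd c).trans h1)).1 hn)))
    intro e he
    rw [mem_outZeros] at he
    refine (hr he.1).trans (Iff.trans ?_ (hr ((X.src_cornerSnd e).trans he.1)).symm)
    have := h.corner e he.2.2
    exact ⟨h.equiv.trans (h.equiv.symm this), h.equiv.trans this⟩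
  -- An isolated outside dart is a component of its own; a second one exists unless this dart is the
  -- only vertex, which is the exceptional case.
  by_cases hval : ∃ x ∈ outDarts Y v, ∀ c ∈ outZeros Y α v,
      X.cornerFst c ≠ x ∧ X.cornerSnd c ≠ x
  · obtain ⟨x, hx, hxc⟩ := hval
    have hsc : ∀ z, signClass Y o z = Sum.inl x → z = x := by
      intro z hz
      unfold signClass at hz
      split_ifs at hz
      simpa using hz
    by_cases hy : ∃ y ∈ (outDarts Y v).disjSum B, y ≠ Sum.inl x
    · left
      obtain ⟨y, hy, hyx⟩ := hy
      refine h.card_add_two_le hB (· = Sum.inl x) ?_ (by simpa using hx) hy rfl hyx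
      intro c hc
      exact ⟨fun hh => absurd (hsc _ hh) (hxc c hc).1, fun hh => absurd (hsc _ hh) (hxc c hc).2⟩
    · right
      push Not at hy
      refine ⟨?_, ⟨x, ?_⟩, ?_⟩
      · rw [Finset.eq_empty_iff_forall_notMem]
        intro b hb
        have := hy (Sum.inr b) (by simpa using hb)
        simp at this
      · rw [Finset.eq_singleton_iff_unique_mem]
        refine ⟨hx, fun y hy' => ?_⟩
        simpa using hy (Sum.inl y) (by simpa using hy')
      · intro c h1
        by_contra h2
        exact (hxc c (mem_outZeros.2 ⟨h1, h2, hzero c h1 h2⟩)).1 (hsc _ (hy _ (hB.fst_mem h1 h2)))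
  · left
    push Not at hval
    have hne : ((outDarts Y v).disjSum B).Nonempty := by
      rcases ht with ⟨d, hd⟩ | ⟨c, h1, h2⟩
      · exact ⟨Sum.inl d, by simpa using mem_outDarts.2 hd⟩
      · exact ⟨_, hB.fst_mem h1 h2⟩
    have h1 := h.card_add_one_le hB hne
    by_contra hcon
    -- Now every outside dart has valence at least two, since it is neither isolated nor on a free
    -- edge.
    have h2 : 2 * (outDarts Y v).card ≤
        ({c ∈ outZeros Y α v | X.cornerFst c ∈ outDarts Y v}).card +
        ({c ∈ outZeros Y α v | X.cornerSnd c ∈ outDarts Y v}).card := by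
      rw [Finset.card_eq_sum_card_fiberwise (f := X.cornerFst) (t := outDarts Y v)
          (s := {c ∈ outZeros Y α v | X.cornerFst c ∈ outDarts Y v})
          (fun c hc => (Finset.mem_filter.1 hc).2),
        Finset.card_eq_sum_card_fiberwise (f := X.cornerSnd) (t := outDarts Y v)
          (s := {c ∈ outZeros Y α v | X.cornerSnd c ∈ outDarts Y v})
          (fun c hc => (Finset.mem_filter.1 hc).2), ← Finset.sum_add_distrib, mul_comm,
        ← smul_eq_mul, ← Finset.sum_const]
      refine Finset.sum_le_sum fun x hx => ?_
      have e1 : ({c ∈ ({c ∈ outZeros Y α v | X.cornerFst c ∈ outDarts Y v} : Finset _) |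
          X.cornerFst c = x} : Finset _) = {c ∈ outZeros Y α v | X.cornerFst c = x} := by
        ext c
        simp only [Finset.mem_filter]
        exact ⟨fun hc => ⟨hc.1.1, hc.2⟩, fun hc => ⟨⟨hc.1, hc.2 ▸ hx⟩, hc.2⟩⟩
      have e2 : ({c ∈ ({c ∈ outZeros Y α v | X.cornerSnd c ∈ outDarts Y v} : Finset _) |
          X.cornerSnd c = x} : Finset _) = {c ∈ outZeros Y α v | X.cornerSnd c = x} := by
        ext c
        simp only [Finset.mem_filter]
        exact ⟨fun hc => ⟨hc.1.1, hc.2⟩, fun hc => ⟨⟨hc.1, hc.2 ▸ hx⟩, hc.2⟩⟩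
      rw [e1, e2]
      have h3 := valence_ne_one hx (hfree x) hzero
      obtain ⟨c, hc, hcx⟩ := hval x hx
      have h4 : 0 < ({c ∈ outZeros Y α v | X.cornerFst c = x}).card +
          ({c ∈ outZeros Y α v | X.cornerSnd c = x}).card := by
        by_cases hf : X.cornerFst c = x
        · exact Nat.add_pos_left (Finset.card_pos.2 ⟨c, Finset.mem_filter.2 ⟨hc, hf⟩⟩) _
        · exact Nat.add_pos_right _
            (Finset.card_pos.2 ⟨c, Finset.mem_filter.2 ⟨hc, hcx hf⟩⟩)
      omega
    have h3 := Finset.card_filter_le (outZeros Y α v) (fun c => X.cornerFst c ∈ outDarts Y v)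
    have h4 := Finset.card_filter_le (outZeros Y α v) (fun c => X.cornerSnd c ∈ outDarts Y v)
    rcases (outDarts Y v).eq_empty_or_nonempty with hD | hD
    · obtain ⟨c, hc1, hc2⟩ := ht.resolve_left (fun ⟨d, hd⟩ => by
        simpa [hD] using mem_outDarts.2 hd)
      have : 0 < (outZeros Y α v).card :=
        Finset.card_pos.2 ⟨c, mem_outZeros.2 ⟨hc1, hc2, hzero c hc1 hc2⟩⟩
      rw [hD, Finset.card_empty] at h1
      omega
    -- The negated bound makes the counts tight: both ends of every outside corner are outside
    -- darts. No sign is met, so the forest bound holds with `B` empty and contradicts the valences.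
    · have h5 := Finset.card_filter_eq_iff.1 (show ({c ∈ outZeros Y α v |
        X.cornerFst c ∈ outDarts Y v}).card = (outZeros Y α v).card by omega)
      have h6 := Finset.card_filter_eq_iff.1 (show ({c ∈ outZeros Y α v |
        X.cornerSnd c ∈ outDarts Y v}).card = (outZeros Y α v).card by omega)
      have hB0 : SignsIn Y o v ∅ := by
        intro c hc1 hc2 b
        have hc := mem_outZeros.2 ⟨hc1, hc2, hzero c hc1 hc2⟩
        exact ⟨fun hy => absurd hy (mem_outDarts.1 (h5 c hc)).2,
          fun hy => absurd hy (mem_outDarts.1 (h6 c hc)).2⟩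
      have h7 := h.card_add_one_le hB0 (by
        obtain ⟨d, hd⟩ := hD
        exact ⟨Sum.inl d, by simpa using hd⟩)
      simp only [Finset.card_empty] at h7
      omega

end Local

end TwoComplex

/-! ### Components of Y and the global count -/

namespace TwoComplex

theorem Subcomplex.Joined.trans_dart {X : TwoComplex.{u}} {Z : X.Subcomplex} {a : X.Vert}
    {d : X.Dart} (h : Z.Joined a (X.src d)) (hd : d ∈ Z.darts) : Z.Joined a (X.tgt d) :=
  h.tail ⟨d, hd, rfl, rfl⟩

/-- The component of `v` in `Y`. -/
def Subcomplex.component {X : TwoComplex.{u}} (Y : X.Subcomplex) (v : X.Vert) : X.Subcomplex where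
  verts := {u | Y.Joined v u}
  darts := {d | d ∈ Y.darts ∧ Y.Joined v (X.src d)}
  faces := {f | f ∈ Y.faces ∧ Y.Joined v (X.src (X.bd f 0))}
  src_mem _ h := h.2
  inv_mem d h := ⟨Y.inv_mem d h.1, h.2.trans_dart h.1⟩
  bd_mem f h i := by
    refine ⟨Y.bd_mem f h.1 i, ?_⟩
    refine ZMod.induction_succ (P := fun i => Y.Joined v (X.src (X.bd f i))) 0 h.2 (fun j hj => ?_) i
    rw [← X.bd_closed]
    exact hj.trans_dart ((Y.bd_mem f h.1 j))

theorem Subcomplex.mem_component_faces {X : TwoComplex.{u}} {Y : X.Subcomplex} {v : X.Vert}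
    {f : X.Face} (hf : f ∈ Y.faces) (i : ZMod (X.len f)) (h : Y.Joined v (X.src (X.bd f i))) :
    f ∈ (Y.component v).faces := by
  refine ⟨hf, ?_⟩
  refine ZMod.induction_succ (P := fun i => Y.Joined v (X.src (X.bd f i))) i h (fun j hj => ?_) 0
  rw [← X.bd_closed]
  exact hj.trans_dart ((Y.bd_mem f hf j))

theorem Subcomplex.conn_component {X : TwoComplex.{u}} (Y : X.Subcomplex) (v : X.Vert) :
    (Y.component v).Conn := by
  have key : ∀ a, Y.Joined v a → (Y.component v).Joined v a := by
    intro a ha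
    induction ha with
    | refl => exact .refl
    | tail hv hxy ih =>
      obtain ⟨d, hd, rfl, rfl⟩ := hxy
      exact ih.tail ⟨d, ⟨hd, hv⟩, rfl, rfl⟩
  exact ⟨⟨v, .refl⟩, fun a ha b hb => (key a ha).symm.trans (key b hb)⟩

theorem isTouched_of_bd {X : TwoComplex.{u}} {Y : X.Subcomplex} {f : X.Face} (hf : f ∉ Y.faces)
    {i : ZMod (X.len f)} {d : X.Dart} (h : X.bd f i = d ∨ X.bd f i = X.inv d) :
    ∃ c : X.Corner, X.cornerVert c = X.src d ∧ c.1 ∉ Y.faces := by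
  rcases h with rfl | h
  · refine ⟨⟨f, i - 1⟩, ?_, hf⟩
    have := X.bd_closed f (i - 1)
    rwa [sub_add_cancel] at this
  · refine ⟨⟨f, i⟩, ?_, hf⟩
    change X.tgt (X.bd f i) = _
    rw [h, X.tgt_inv]

/-- Both endpoints of a side of an outside face carry a corner of that face. So a dart of `Y` met by
an outside corner leads to another place where the outside is met, possibly the same vertex. -/
theorem isTouched_tgt_end {X : TwoComplex.{u}} {Y : X.Subcomplex} {c : X.Corner}
    (hc : c.1 ∉ Y.faces) {x : X.Dart} (hx : x = X.cornerFst c ∨ x = X.cornerSnd c) :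
    IsTouched Y (X.tgt x) := by
  right
  rw [← X.src_inv]
  rcases hx with rfl | rfl
  · exact isTouched_of_bd hc (i := c.2) (.inl (X.inv_inv _).symm)
  · exact isTouched_of_bd hc (i := c.2 + 1) (.inr (X.inv_inv _).symm)

theorem SignsIn.of_forall {X : TwoComplex.{u}} {Y : X.Subcomplex} {o : X.Orientation}
    {v : X.Vert} {B : Finset Bool}
    (h : ∀ x ∈ Y.darts, X.src x = v → IsTouched Y (X.tgt x) → ∀ b : Bool, (o.pos x ↔ b = true) →
      b ∈ B) : SignsIn Y o v B := by
  intro c h1 h2 b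
  exact ⟨fun hY => h _ hY h1 (isTouched_tgt_end h2 (.inl rfl)) b,
    fun hY => h _ hY ((X.src_cornerSnd c).trans h1) (isTouched_tgt_end h2 (.inr rfl)) b⟩

/-- A component of `Y` that meets the outside in a single vertex, in one dart that is in no face,
contains free cells of `X`, if it is collapsible. -/
theorem Subcomplex.exists_free_of_component {X : TwoComplex.{u}} {Y : X.Subcomplex} {v w : X.Vert}
    (hw : Y.Joined v w) (hT : ∀ u, Y.Joined v u → IsTouched Y u → u = w)
    (hcor : ∀ c : X.Corner, X.cornerVert c = w → c.1 ∈ Y.faces) {d : X.Dart}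
    (hd : X.src d = w) (hdY : d ∉ Y.darts) (hd' : ∀ d', X.src d' = w → d' ∉ Y.darts → d' = d)
    (h : ((Y.component v).verts = {w} ∧ (Y.component v).darts = ∅) ∨
      (∃ e, (Y.component v).IsFreeEdge e) ∨ ∃ u, u ≠ w ∧ (Y.component v).IsFreeVert u) :
    (∃ e, X.IsFreeEdge e) ∨ ∃ u, X.IsFreeVert u := by
  -- An outside face along `e` would have a corner at a touched vertex of the component, hence at
  -- `w`, where all corners are in `Y`.
  have hface : ∀ e, Y.Joined v (X.src e) → ∀ f i, (X.bd f i = e ∨ X.bd f i = X.inv e) →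
      f ∈ Y.faces := by
    intro e he f i hi
    by_contra hf
    obtain ⟨c, h1, h2⟩ := isTouched_of_bd hf hi
    exact h2 (hcor c (h1.trans (hT _ he (.inr ⟨c, h1, h2⟩))))
  have hface' : ∀ e ∈ Y.darts, Y.Joined v (X.src e) → ∀ f i,
      (X.bd f i = e ∨ X.bd f i = X.inv e) → f ∈ (Y.component v).faces := by
    intro e heY he f i hi
    refine mem_component_faces (hface e he f i hi) i ?_
    rcases hi with h | h
    · exact h ▸ he
    · rw [h]
      exact he.trans_dart (heY)
  rcases h with ⟨-, h⟩ | ⟨e, ⟨f, i⟩, ⟨hf, hi⟩, huniq⟩ | ⟨u, hu, e, he, rfl, h1, h2⟩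
  -- If the component is a point, `w` itself is free, with `d` as its only dart.
  · refine .inr ⟨w, d, hd, fun d' hw' => hd' d' hw' fun hY => ?_, fun f i => ?_⟩
    · have : d' ∈ (Y.component v).darts := ⟨hY, hw' ▸ hw⟩
      rw [h] at this
      exact this
    · by_contra hcon
      have hf := hface d (hd ▸ hw) f i (by tauto)
      have := Y.bd_mem f hf i
      by_cases h3 : X.bd f i = d
      · exact hdY (h3 ▸ this)
      · have h4 : X.bd f i = X.inv d := by tauto
        have := Y.inv_mem _ this
        rw [h4, X.inv_inv] at this
        exact hdY this
  · have he : e ∈ (Y.component v).darts := by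
      have := (Y.component v).bd_mem f hf i
      rcases hi with h | h
      · exact h ▸ this
      · have := (Y.component v).inv_mem _ this
        rwa [h, X.inv_inv] at this
    exact .inl ⟨e, ⟨f, i⟩, hi, fun s hs => huniq s ⟨hface' e he.1 he.2 s.1 s.2 hs, hs⟩⟩
  · refine .inr ⟨X.src e, e, rfl, fun d' hs => ?_, fun f i => ?_⟩
    · by_cases hY : d' ∈ Y.darts
      · exact h1 d' ⟨hY, hs ▸ he.2⟩ hs
      · exact absurd (hT _ he.2 (.inl ⟨d', hs, hY⟩)) hu
    · by_contra hcon
      have := h2 f (hface' e he.1 he.2 f i (by tauto)) i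
      tauto

section Global

variable {X : TwoComplex.{u}} [Fintype X.Vert] [Fintype X.Dart] [Fintype X.Face]
  {Y : X.Subcomplex} {o : X.Orientation} {α : X.Corner → ℤ}
  {J : X.Dart → X.Dart → Prop} {Jx : X.Corner → X.Dart → X.Dart → Prop}

/-- The number of darts at `v` minus the number of corners of angle zero at `v`, outside `Y`. -/
noncomputable def excess (Y : X.Subcomplex) (α : X.Corner → ℤ) (v : X.Vert) : ℤ :=
  (outDarts Y v).card - (outZeros Y α v).card

-- A component that is not collapsible has nonpositive `chi2`, and excesses are nonnegative. For a
-- collapsible one an excess of 2 is found at extremal touched vertices of its height function.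
open Classical in
theorem IsSeparated.chi2_component_le (h : IsSeparated X Y o α J Jx) (hYv : Y.verts = Set.univ)
    (hfE : ∀ d, ¬ X.IsFreeEdge d) (hfV : ∀ v, ¬ X.IsFreeVert v)
    (hY : ∀ f ∈ Y.faces, o.expSum (X.bd f) = 0)
    (hnpi : ∀ Z : X.Subcomplex, Z.Le Y → Z.Conn → (∀ v, ¬ Z.IsFreeVert v) →
      (∀ d, ¬ Z.IsFreeEdge d) → Z.chi2 ≤ 0 ∨ (∃ v, Z.verts = {v}) ∧ Z.darts = ∅)
    (v : X.Vert) (ht : ∃ u, Y.Joined v u ∧ IsTouched Y u) :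
    (Y.component v).chi2 ≤ ∑ u with Y.Joined v u, excess Y α u := by
  have hX : X.IsFinite := ⟨inferInstance, inferInstance, inferInstance⟩
  have hnn : ∀ u, 0 ≤ excess Y α u := fun u => by
    have := h.card_outZeros_le u
    unfold excess
    omega
  rcases Subcomplex.collapsible hX hY hnpi _ (Y.component v) rfl
    ⟨hYv ▸ Set.subset_univ _, fun d hd => hd.1, fun f hf => hf.1⟩ (Y.conn_component v) with
    h0 | ⟨h2, ⟨k, hk⟩, hcol⟩
  · exact h0.trans (Finset.sum_nonneg fun u _ => hnn u)
  rw [h2]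
  let T : Finset X.Vert := {u | Y.Joined v u ∧ IsTouched Y u}
  have hmT : ∀ u, u ∈ T ↔ Y.Joined v u ∧ IsTouched Y u := fun u => by simp [T]
  have hTne : T.Nonempty := by
    obtain ⟨u, hu⟩ := ht
    exact ⟨u, (hmT u).2 hu⟩
  have hnext : ∀ u ∈ T, ∀ x ∈ Y.darts, X.src x = u → IsTouched Y (X.tgt x) →
      X.tgt x ∈ T ∧ k (X.tgt x) = k u + o.sgn x := by
    rintro _ hu x hx rfl hxt
    have hu := ((hmT _).1 hu).1
    exact ⟨(hmT _).2 ⟨hu.trans_dart (hx), hxt⟩, hk x ⟨hx, hu⟩⟩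
  have hone : ∀ u ∈ T, ∀ b : Bool, SignsIn Y o u {b} → 1 ≤ excess Y α u := by
    intro u hu b hB
    rcases h.card_outZeros_lt hfE hB (by simp) ((hmT u).1 hu).2 with h3 | ⟨h3, -⟩
    · simp only [Finset.card_singleton] at h3
      unfold excess
      omega
    · simp at h3
  have hmax : ∀ u ∈ T, (∀ w ∈ T, k w ≤ k u) → 1 ≤ excess Y α u := by
    intro u hu hm
    -- From a highest touched vertex the darts of `Y` that are met lead to touched vertices, hence
    -- downwards: all are negative.
    refine hone u hu false (SignsIn.of_forall fun x hx hxu hxt b hb => ?_)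
    obtain ⟨h3, h4⟩ := hnext u hu x hx hxu hxt
    have h5 := hm _ h3
    cases b with
    | false => simp
    | true =>
      have h6 : o.sgn x = 1 := if_pos (hb.2 rfl)
      omega
  have hmin : ∀ u ∈ T, (∀ w ∈ T, k u ≤ k w) → 1 ≤ excess Y α u := by
    intro u hu hm
    refine hone u hu true (SignsIn.of_forall fun x hx hxu hxt b hb => ?_)
    obtain ⟨h3, h4⟩ := hnext u hu x hx hxu hxt
    have h5 := hm _ h3
    cases b with
    | true => simp
    | false =>
      have h6 : o.sgn x = -1 := if_neg (by simp [hb])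
      omega
  obtain ⟨u₁, hu₁, hu₁m⟩ := T.exists_max_image k hTne
  obtain ⟨u₂, hu₂, hu₂m⟩ := T.exists_min_image k hTne
  have hsub : ∀ u ∈ T, u ∈ ({u | Y.Joined v u} : Finset X.Vert) := fun u hu => by
    simpa using ((hmT u).1 hu).1
  by_cases hex : ∃ u₃ ∈ T, u₃ ≠ u₁
  · have h3 : ∃ u' ∈ T, u' ≠ u₁ ∧ 1 ≤ excess Y α u' := by
      by_cases h12 : u₂ = u₁
      · obtain ⟨u₃, hu₃, hne⟩ := hex
        -- Here the extremal heights agree, so every touched vertex is a highest one.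
        refine ⟨u₃, hu₃, hne, hmax u₃ hu₃ fun w hw => ?_⟩
        have := hu₁m w hw
        have := hu₂m u₃ hu₃
        rw [h12] at this
        omega
      · exact ⟨u₂, hu₂, h12, hmin u₂ hu₂ hu₂m⟩
    obtain ⟨u', hu', hne, h4⟩ := h3
    have h5 := hmax u₁ hu₁ hu₁m
    calc (2 : ℤ) ≤ excess Y α u' + excess Y α u₁ := by omega
      _ = ∑ u ∈ {u', u₁}, excess Y α u := (Finset.sum_pair hne).symm
      _ ≤ _ := Finset.sum_le_sum_of_subset_of_nonneg (by
          intro u hu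
          rcases Finset.mem_insert.1 hu with rfl | hu
          · exact hsub _ hu'
          · exact Finset.mem_singleton.1 hu ▸ hsub _ hu₁) (fun u _ _ => hnn u)
  · push Not at hex
    -- A dart of `Y` met here would be a loop at `u₁`, but the height changes along every dart of
    -- the component.
    have hB : SignsIn Y o u₁ ∅ := SignsIn.of_forall fun x hx hxu hxt b hb => by
      obtain ⟨h3, h4⟩ := hnext u₁ hu₁ x hx hxu hxt
      rw [hex _ h3] at h4
      have : o.sgn x = 1 ∨ o.sgn x = -1 := by
        unfold SerreGraph.Orientation.sgn
        split_ifs <;> simp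
      omega
    have hu₁' := (hmT u₁).1 hu₁
    rcases h.card_outZeros_lt hfE hB (by simp) hu₁'.2 with h3 | ⟨-, ⟨d, hd⟩, hcor⟩
    · have h4 : 2 ≤ excess Y α u₁ := by
        simp only [Finset.card_empty] at h3
        unfold excess
        omega
      exact h4.trans (Finset.single_le_sum (fun u _ => hnn u) (hsub _ hu₁))
    · exfalso
      have hdm := mem_outDarts.1 (hd ▸ Finset.mem_singleton_self d : d ∈ outDarts Y u₁)
      rcases Subcomplex.exists_free_of_component hu₁'.1
        (fun u h3 h4 => hex u ((hmT u).2 ⟨h3, h4⟩)) hcor hdm.1 hdm.2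
        (fun d' h3 h4 => by
          have := mem_outDarts.2 ⟨h3, h4⟩
          rwa [hd, Finset.mem_singleton] at this) (hcol u₁ hu₁'.1) with ⟨e, he⟩ | ⟨u, hu⟩
      · exact hfE e he
      · exact hfV u hu

open Classical in
/-- The Euler characteristic is the sum over the components of `Y`, plus the outside cells. -/
theorem euler_nonpos_of_components
    (hle : ∀ v, (Y.component v).chi2 ≤ ∑ u with Y.Joined v u, excess Y α u)
    (hcurv : ∀ f, f ∉ Y.faces → 2 ≤ ({i | α ⟨f, i⟩ = 0} : Finset (ZMod (X.len f))).card) :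
    X.euler ≤ 0 := by
  have hX : X.IsFinite := ⟨inferInstance, inferInstance, inferInstance⟩
  let S : Setoid X.Vert := ⟨Y.Joined, fun _ => .refl, .symm, Relation.ReflTransGen.trans⟩
  have : Fintype (Quotient S) := Fintype.ofFinite _
  have hq : ∀ (q : Quotient S) (u : X.Vert), Y.Joined q.out u ↔ Quotient.mk S u = q := by
    intro q u
    constructor
    · intro h
      rw [← q.out_eq]
      exact Quotient.sound (s := S) (Subcomplex.Joined.symm h)
    · rintro rfl
      exact Quotient.mk_out (s := S) u
  have hchi : ∀ q : Quotient S, (Y.component q.out).chi2 =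
      2 * ({u | Quotient.mk S u = q} : Finset X.Vert).card -
        ({d ∈ ({d | d ∈ Y.darts} : Finset X.Dart) | Quotient.mk S (X.src d) = q}).card +
        2 * ({f ∈ ({f | f ∈ Y.faces} : Finset X.Face) | Quotient.mk S (X.src (X.bd f 0)) = q}).card := by
    intro q
    rw [← Set.ncard_coe_finset, ← Set.ncard_coe_finset, ← Set.ncard_coe_finset]
    simp only [Finset.coe_filter, Finset.mem_filter, Finset.mem_univ, true_and, ← hq]
    rfl
  have h1 : ∑ q : Quotient S, (Y.component q.out).chi2 ≤ ∑ u, excess Y α u := by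
    rw [← Finset.sum_fiberwise Finset.univ (Quotient.mk S)]
    refine Finset.sum_le_sum fun q _ => (hle q.out).trans_eq ?_
    simp only [hq]
  have h2 : ∑ q : Quotient S, (Y.component q.out).chi2 =
      2 * Fintype.card X.Vert - ({d | d ∈ Y.darts} : Finset X.Dart).card +
        2 * ({f | f ∈ Y.faces} : Finset X.Face).card := by
    rw [← Finset.card_univ,
      Finset.card_eq_sum_card_fiberwise (f := Quotient.mk S) (s := Finset.univ) (t := Finset.univ)
        (fun _ _ => Finset.mem_univ _),
      Finset.card_eq_sum_card_fiberwise (f := fun d => Quotient.mk S (X.src d))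
        (s := {d | d ∈ Y.darts}) (t := Finset.univ) (fun _ _ => Finset.mem_univ _),
      Finset.card_eq_sum_card_fiberwise (f := fun f => Quotient.mk S (X.src (X.bd f 0)))
        (s := {f | f ∈ Y.faces}) (t := Finset.univ) (fun _ _ => Finset.mem_univ _)]
    push_cast
    rw [Finset.mul_sum, Finset.mul_sum, ← Finset.sum_sub_distrib, ← Finset.sum_add_distrib]
    exact Finset.sum_congr rfl fun q _ => hchi q
  have h3 : ∑ u, (outDarts Y u).card = ({d | d ∉ Y.darts} : Finset X.Dart).card := by
    rw [Finset.card_eq_sum_card_fiberwise (f := X.src) (s := {d | d ∉ Y.darts})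
      (t := Finset.univ) (fun _ _ => Finset.mem_univ _)]
    refine Finset.sum_congr rfl fun u _ => congrArg Finset.card ?_
    ext d
    simp [mem_outDarts, and_comm]
  have h4 : ∑ u, (outZeros Y α u).card =
      ({c | c.1 ∉ Y.faces ∧ α c = 0} : Finset X.Corner).card := by
    rw [Finset.card_eq_sum_card_fiberwise (f := X.cornerVert)
      (s := {c | c.1 ∉ Y.faces ∧ α c = 0})
      (t := Finset.univ) (fun _ _ => Finset.mem_univ _)]
    refine Finset.sum_congr rfl fun u _ => congrArg Finset.card ?_
    ext c
    simp [mem_outZeros, and_comm]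
  -- Two corners of angle 0 per outside face pay for its contribution to twice the Euler
  -- characteristic.
  have h5 : ({f | f ∉ Y.faces} : Finset X.Face).card * 2 ≤
      ({c | c.1 ∉ Y.faces ∧ α c = 0} : Finset X.Corner).card := by
    calc _ ≤ ∑ f with f ∉ Y.faces, ({i | α ⟨f, i⟩ = 0} : Finset (ZMod (X.len f))).card := by
          rw [← smul_eq_mul]
          exact Finset.card_nsmul_le_sum _ _ _ fun f hf => hcurv f (by simpa using hf)
      _ = (({f | f ∉ Y.faces} : Finset X.Face).sigma
            fun f => ({i | α ⟨f, i⟩ = 0} : Finset (ZMod (X.len f)))).card :=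
          (Finset.card_sigma _ _).symm
      _ ≤ _ := Finset.card_le_card (by
          rintro ⟨f, i⟩ hc
          simpa using hc)
  have h6 : ∑ u, excess Y α u = ({d | d ∉ Y.darts} : Finset X.Dart).card -
      ({c | c.1 ∉ Y.faces ∧ α c = 0} : Finset X.Corner).card := by
    rw [← h3, ← h4]
    push_cast
    rw [← Finset.sum_sub_distrib]
    rfl
  have h7 := Finset.card_filter_add_card_filter_not (s := (Finset.univ : Finset X.Dart))
    (fun d => d ∈ Y.darts)
  have h8 := Finset.card_filter_add_card_filter_not (s := (Finset.univ : Finset X.Face))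
    (fun f => f ∈ Y.faces)
  have h9 := two_mul_euler hX
  rw [Nat.card_eq_fintype_card, Nat.card_eq_fintype_card, Nat.card_eq_fintype_card] at h9
  rw [Finset.card_univ] at h7 h8
  omega

end Global

end TwoComplex

/-! ### Pulling back the coloring test -/

namespace TwoComplex

theorem Subcomplex.IsFreeVert.of_full {X : TwoComplex.{u}} {v : X.Vert}
    (h : (Subcomplex.full X).IsFreeVert v) : X.IsFreeVert v := by
  obtain ⟨d, -, h1, h2, h3⟩ := h
  exact ⟨d, h1, fun d' => h2 d' trivial, fun f => h3 f trivial⟩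

theorem Subcomplex.IsFreeEdge.of_full {X : TwoComplex.{u}} {d : X.Dart}
    (h : (Subcomplex.full X).IsFreeEdge d) : X.IsFreeEdge d := by
  obtain ⟨s, h1, h2⟩ := h
  exact ⟨s, h1.2, fun t ht => h2 t ⟨trivial, ht⟩⟩

theorem Subcomplex.chi2_full {X : TwoComplex.{u}} (hX : X.IsFinite) :
    (Subcomplex.full X).chi2 = 2 * X.euler := by
  rw [two_mul_euler hX]
  simp [chi2, full, Set.ncard_univ]

/-- If a component of `Y` does not touch the outside, then `Y` is everything. -/
theorem full_le_of_not_isTouched {X : TwoComplex.{u}} (hc : X.IsConnected) {Y : X.Subcomplex}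
    (hYv : Y.verts = Set.univ) {v : X.Vert} (hv : ∀ u, Y.Joined v u → ¬ IsTouched Y u) :
    (Subcomplex.full X).Le Y := by
  have hd : ∀ d, Y.Joined v (X.src d) → d ∈ Y.darts := fun d hd => by
    by_contra hdY
    exact hv _ hd (.inl ⟨d, rfl, hdY⟩)
  have hall : ∀ u, Y.Joined v u := by
    intro u
    have := hc.2 v u
    induction this with
    | refl => exact .refl
    | tail _ hxy ih =>
      obtain ⟨d, rfl, rfl⟩ := hxy
      exact ih.trans_dart (hd d ih)
  refine ⟨hYv ▸ Set.subset_univ _, fun d _ => hd d (hall _), fun f _ => ?_⟩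
  by_contra hf
  exact hv _ (hall _) (.inr ⟨⟨f, 0⟩, rfl, hf⟩)

theorem IsSeparated.euler_nonpos_or_point {X : TwoComplex.{u}} {Y : X.Subcomplex}
    {o : X.Orientation} {α : X.Corner → ℤ} {J : X.Dart → X.Dart → Prop}
    {Jx : X.Corner → X.Dart → X.Dart → Prop} (h : IsSeparated X Y o α J Jx) (hX : X.IsFinite)
    (hc : X.IsConnected) (hYv : Y.verts = Set.univ)
    (hfE : ∀ d, ¬ X.IsFreeEdge d) (hfV : ∀ v, ¬ X.IsFreeVert v)
    (hY : ∀ f ∈ Y.faces, o.expSum (X.bd f) = 0)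
    (hnpi : ∀ Z : X.Subcomplex, Z.Le Y → Z.Conn → (∀ v, ¬ Z.IsFreeVert v) →
      (∀ d, ¬ Z.IsFreeEdge d) → Z.chi2 ≤ 0 ∨ (∃ v, Z.verts = {v}) ∧ Z.darts = ∅)
    (hcurv : ∀ f, ∑ i, α ⟨f, i⟩ ≤ (X.len f : ℤ) - 2) : X.euler ≤ 0 ∨ X.IsPoint := by
  classical
  by_cases ht : ∀ v, ∃ u, Y.Joined v u ∧ IsTouched Y u
  · left
    obtain ⟨h1, h2, h3⟩ := hX
    have := Fintype.ofFinite X.Vert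
    have := Fintype.ofFinite X.Dart
    have := Fintype.ofFinite X.Face
    refine euler_nonpos_of_components
      (fun v => by convert h.chi2_component_le hYv hfE hfV hY hnpi v (ht v)) fun f _ => ?_
    -- The angle sum is the length minus the number of zeros, so nonpositive curvature means at
    -- least two zeros.
    have h4 : ∑ i, α ⟨f, i⟩ =
        ∑ i : ZMod (X.len f), ((1 : ℤ) - if α ⟨f, i⟩ = 0 then 1 else 0) := by
      refine Finset.sum_congr rfl fun i _ => ?_
      rcases h.zero_or_one ⟨f, i⟩ with h | h <;> simp [h]
    have h5 := hcurv f
    rw [h4, Finset.sum_sub_distrib, Finset.sum_boole] at h5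
    simp only [Finset.sum_const, Finset.card_univ, ZMod.card, nsmul_eq_mul, mul_one] at h5
    omega
  · push Not at ht
    obtain ⟨v, hv⟩ := ht
    have hle := full_le_of_not_isTouched hc hYv hv
    have hconn : (Subcomplex.full X).Conn := by
      refine ⟨⟨v, trivial⟩, fun a _ b _ => ?_⟩
      exact Relation.ReflTransGen.mono (fun x y ⟨d, hd⟩ => ⟨d, trivial, hd⟩) _ _ (hc.2 a b)
    rcases hnpi _ hle hconn (fun v h => hfV v (Subcomplex.IsFreeVert.of_full h))
      (fun d h => hfE d (Subcomplex.IsFreeEdge.of_full h)) with h1 | ⟨⟨w, h1⟩, h2⟩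
    · left
      rw [Subcomplex.chi2_full hX] at h1
      omega
    · right
      have h3 : IsEmpty X.Dart := Set.univ_eq_empty_iff.1 h2
      refine ⟨?_, h3, ⟨fun f => h3.false (X.bd f 0)⟩⟩
      rw [← Set.ncard_univ]
      exact Set.ncard_eq_one.2 ⟨w, h1⟩

/-- The corners of `L` as corners of the maximal expansion. -/
def expandCorner {L : TwoComplex.{u}} (K : L.Subcomplex) (o : L.Orientation) (c : L.Corner) :
    (L.maxExpansion K o).Corner :=
  ⟨Sum.inl c.1, c.2⟩

theorem expandCorner_injective {L : TwoComplex.{u}} (K : L.Subcomplex) (o : L.Orientation) :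
    Function.Injective (expandCorner K o) := by
  rintro ⟨f, i⟩ ⟨g, j⟩ h
  cases h
  rfl

theorem expandCorner_mem {L : TwoComplex.{u}} {K : L.Subcomplex} {o : L.Orientation}
    {c : L.Corner} : (expandCorner K o c).1 ∈ (K.maxExpansion o).faces ↔ c.1 ∈ K.faces :=
  ⟨fun h => h _ rfl, fun h _ hf => Sum.inl_injective hf ▸ h⟩

/-- The purpose of the maximal expansion: the joining corner lies in K̂, so deleting corners outside
K̂ does not affect it. -/
theorem linkJoined_of_same_sign {L : TwoComplex.{u}} {K : L.Subcomplex} {o : L.Orientation}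
    {ω : (L.maxExpansion K o).Corner → ℤ} (hstd : (K.maxExpansion o).IsStandardOn o ω)
    {T : Set (L.maxExpansion K o).Corner} (hT : ∀ c ∈ T, c.1 ∉ (K.maxExpansion o).faces)
    {x y : L.Dart} (hx : x ∈ K.darts) (hy : y ∈ K.darts) (hxy : L.src x = L.src y)
    (hs : o.pos x ↔ o.pos y) : (L.maxExpansion K o).LinkJoined ω T x y := by
  obtain ⟨c, hc, rfl, rfl⟩ := K.exists_corner_maxExpansion o hx hy hxy
  exact .of_corner ((hstd c hc).1 hs) fun h => hT c h hc

theorem Hom.linkJoined_onCorner {X L : TwoComplex.{u}} (φ : X.Hom L) {K : L.Subcomplex}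
    {o : L.Orientation} {ω : (L.maxExpansion K o).Corner → ℤ}
    {T : Set (L.maxExpansion K o).Corner} {c : X.Corner} :
    (L.maxExpansion K o).LinkJoined ω T (φ.onDart (X.cornerFst c)) (φ.onDart (X.cornerSnd c)) ↔
      (L.maxExpansion K o).LinkJoined ω T
        ((L.maxExpansion K o).cornerFst (expandCorner K o (φ.onCorner c)))
        ((L.maxExpansion K o).cornerSnd (expandCorner K o (φ.onCorner c))) := by
  have h1 : (L.maxExpansion K o).cornerFst (expandCorner K o (φ.onCorner c)) =
    L.cornerFst (φ.onCorner c) := rfl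
  have h2 : (L.maxExpansion K o).cornerSnd (expandCorner K o (φ.onCorner c)) =
    L.cornerSnd (φ.onCorner c) := rfl
  rw [h1, h2]
  rcases φ.ends_onCorner c with ⟨h3, h4⟩ | ⟨h3, h4⟩
  · rw [h3, h4]
  · rw [h3, h4]
    exact ⟨LinkJoined.symm, LinkJoined.symm⟩

/-- All joining takes place in the links of L̂, between images of darts, so no path ever has to be
lifted to X. -/
theorem Hom.isSeparated {X L : TwoComplex.{u}} {φ : X.Hom L} (hφ : φ.IsImmersion)
    {K : L.Subcomplex} {o : L.Orientation} {ω : (L.maxExpansion K o).Corner → ℤ}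
    (hω : (L.maxExpansion K o).IsZeroOne ω)
    (htest : (L.maxExpansion K o).StrongRelColoringTest (K.maxExpansion o) ω)
    (hstd : (K.maxExpansion o).IsStandardOn o ω) :
    IsSeparated X (φ.preimage K) (φ.orientation o)
      (fun c => ω (expandCorner K o (φ.onCorner c)))
      (fun x y => (L.maxExpansion K o).LinkJoined ω ∅ (φ.onDart x) (φ.onDart y))
      (fun c x y => (L.maxExpansion K o).LinkJoined ω {expandCorner K o (φ.onCorner c)}
        (φ.onDart x) (φ.onDart y)) := by
  have hsrc : ∀ x y : X.Dart, X.src x = X.src y →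
      L.src (φ.onDart x) = L.src (φ.onDart y) := fun x y h => by
    rw [φ.src_onDart, φ.src_onDart, h]
  have hout : ∀ c : X.Corner, c.1 ∉ (φ.preimage K).faces →
      (expandCorner K o (φ.onCorner c)).1 ∉ (K.maxExpansion o).faces :=
    fun c hc h => hc ((expandCorner_mem (K := K) (o := o)).1 h)
  have heq := fun T => LinkJoined.equivalence (L.maxExpansion K o) ω T
  refine
    { zero_or_one := fun c => hω _
      equiv := ⟨fun _ => (heq _).refl _, (heq _).symm, (heq _).trans⟩
      equiv_avoid := fun c => ⟨fun _ => (heq _).refl _, (heq _).symm, (heq _).trans⟩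
      corner := fun c hc => φ.linkJoined_onCorner.2 (.of_corner hc (Set.notMem_empty _))
      corner_avoid := fun c c' _ hv hc' hne => φ.linkJoined_onCorner.2 (.of_corner hc' ?_)
      not_corner_avoid := fun c hc hz hj =>
        htest.not_linkJoined_of_zero hz (hout c hc) (φ.linkJoined_onCorner.1 hj)
      not_corner := fun c hc hz hj =>
        htest.not_linkJoined_of_one hz (hout c hc) (φ.linkJoined_onCorner.1 hj)
      same_sign := fun x hx y hy hxy hs =>
        linkJoined_of_same_sign hstd (by simp) hx hy (hsrc x y hxy) hs
      same_sign_avoid := fun c hc x hx y hy hxy hs =>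
        linkJoined_of_same_sign hstd (by simpa using hout c hc) hx hy (hsrc x y hxy) hs
      sign_eq := fun x hx y hy hxy hj =>
        htest.pos_iff_of_linkJoined hstd hx hy (hsrc x y hxy) hj }
  -- By local injectivity, different corners at one vertex have different images, so the image of
  -- `c'` is not the deleted corner.
  intro hm
  exact hne (hφ.2 c' c hv.symm (expandCorner_injective K o hm))

end TwoComplex

theorem theorem3p4 (L : TwoComplex.{u}) (o : L.Orientation) (K : L.Subcomplex)
    (hK : K.ExpSumZero o)
    (ω : (L.maxExpansion K o).Corner → ℤ)
    (hω : (L.maxExpansion K o).IsZeroOne ω)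
    (htest : (L.maxExpansion K o).StrongRelColoringTest (K.maxExpansion o) ω)
    (hstd : (K.maxExpansion o).IsStandardOn o ω)
    (hnpi : K.toComplex.CollapsingNPI) :
    L.CollapsingNPI := by
  intro X φ hφ hX hc hfV hfE
  refine (φ.isSeparated hφ hω htest hstd).euler_nonpos_or_point hX hc rfl hfE hfV
    (fun f hf => φ.expSum_orientation o f (hK _ hf))
    (fun Z hZ hZc h1 h2 => TwoComplex.Hom.preimage_npi hφ hX hnpi hZ hZc h1 h2) fun f => ?_
  -- The map preserves boundary lengths and pulled-back angle sums, so faces of X inherit the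
  -- curvature bound from L̂.
  have h1 := htest.1 (Sum.inl (φ.onFace f))
  have h2 := φ.sum_onCorner (fun c => ω (TwoComplex.expandCorner K o c)) f
  have h3 : ∑ i : ZMod (L.len (φ.onFace f)),
      ω (TwoComplex.expandCorner K o ⟨φ.onFace f, i⟩) - ((L.len (φ.onFace f) : ℤ) - 2) ≤ 0 := h1
  rw [← h2, φ.len_onFace] at h3
  linarith
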